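/- **Setting.** A base station with an $N_{th}\times N_{tv}$ transmit array ($N_t=N_{th}N_{tv}$ antennas) serves $K$ single-antenna users. Let $\beta_k>0$ be the large-scale fading parameters, $\sigma_c^2>0$ the noise variance, $\mathbf p_k\in\mathbb C^{\tau_p}$ with $\|\mathbf p_k\|=1$ the pilot sequences, $p_p>0$ the training power, $0<\tau_p<\tau_c$ the pilot length and the coherence interval, $\bar\tau=(\tau_c-\tau_p)/\tau_c$, and $$\xi_k=\frac{\tau_p p_p\beta_k^2}{\tau_p p_p\sum_{j=1}^K\beta_j|\mathbf p_j^{\mathsf H}\mathbf p_k|^2+\sigma_c^2},\qquad \epsilon_k=\beta_k-\xi_k .$$ The channel matrix $\mathbf H=[\mathbf h_1,\dots,\mathbf h_K]\in\mathbb C^{N_t\times K}$ and its estimate $\hat{\mathbf H}=[\hat{\mathbf h}_1,\dots,\hat{\mathbf h}_K]$ are random matrices satisfying one of the following descriptions of Rayleigh fading with MMSE channel estimation: (a) $\hat{\mathbf h}_1,\dots,\hat{\mathbf h}_K$ are independent with $\hat{\mathbf h}_k\sim\mathcal{CN}(0,\xi_k\mathbf I_{N_t})$, and for each $k$ the error $\mathbf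 e_k=\mathbf h_k-\hat{\mathbf h}_k\sim\mathcal{CN}(0,\epsilon_k\mathbf I_{N_t})$ is independent of $\hat{\mathbf H}$; or (b) the pilots of distinct users are orthogonal, $\mathbf h_k=\sqrt{\beta_k}\,\bar{\mathbf h}_k$ with independent $\bar{\mathbf h}_k\sim\mathcal{CN}(0,\mathbf I_{N_t})$, and $\hat{\mathbf h}_k=\mathbb E[\mathbf h_k\mid\mathbf Y]$, where $\mathbf Y=\sqrt{\tau_p p_p}\sum_j\mathbf h_j\mathbf p_j^{\mathsf H}+\mathbf N$ is the training signal and $\mathbf N$ has i.i.d. $\mathcal{CN}(0,\sigma_c^2)$ entries and is independent of the channels. Let $\mathbf W=\hat{\mathbf H}$ (MRT) or $\mathbf W=\hat{\mathbf H}(\hat{\mathbf H}^{\mathsf H}\hat{\mathbf H})^{-1}$ (ZF), where $K<N_t$ is required for ZF. Let $\gamma_k,\eta_k\ge 0$, $\rho=\sum_k\eta_k$, and let $\mathbf v\in\mathbb C^{N_t}$ be a deterministic sensing beam with $\|\mathbf v\|^2=N_t$ (for example an array steering vector). The precoding vectors are $\mathbf f_k=\sqrt{\gamma_k}\,\mathbf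 w_k+\sqrt{\eta_k}\,\mathbf v$, and the achievable rate of user $k$ is $$R_k=\bar\tau\log_2\!\left(1+\frac{|\mathbb E[\mathbf h_k^{\mathsf H}\mathbf f_k]|^2}{\mathbb E\big|\mathbf h_k^{\mathsf H}\mathbf f_k-\mathbb E[\mathbf h_k^{\mathsf H}\mathbf f_k]\big|^2+\sum_{j\ne k}\mathbb E|\mathbf h_k^{\mathsf H}\mathbf f_j|^2+\sigma_c^2}\right).$$ **Theorem.** All the gains $\mathbf h_k^{\mathsf H}\mathbf f_j$ are square integrable, and for every user $k$ $$R_k=\bar\tau\log_2\!\left(1+\frac{\lambda_k\gamma_k}{N_t\beta_k\rho+N_t\boldsymbol\zeta_k^{\mathsf T}\boldsymbol\gamma+\sigma_c^2}\right),\qquad \boldsymbol\gamma=[\gamma_1,\dots,\gamma_K]^{\mathsf T},$$ where $\lambda_k=N_t^2\xi_k^2$, $\boldsymbol\zeta_k=\beta_k[\xi_1,\dots,\xi_K]^{\mathsf T}$ for MRT, and $\lambda_k=1$, $\boldsymbol\zeta_k=\frac{\epsilon_k}{N_t(N_t-K)}\left[\frac1{\xi_1},\dots,\frac1{\xi_K}\right]^{\mathsf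 T}$ for ZF. -/

import Mathlib

open MeasureTheory ProbabilityTheory
open scoped Matrix

namespace ISAC

/-! ### Circularly symmetric complex Gaussian laws -/

/-- The law `CN(0, s)` on `ℂ`: independent real and imaginary parts, each `N(0, s / 2)`. -/
noncomputable def complexGaussian (s : ℝ) : Measure ℂ :=
  ((gaussianReal 0 (s / 2).toNNReal).prod (gaussianReal 0 (s / 2).toNNReal)).map
    (fun p : ℝ × ℝ => (⟨p.1, p.2⟩ : ℂ))

/-- The law `CN(0, s I)` on `ℂ^ι`: independent coordinates, each `CN(0, s)`. -/
noncomputable def complexGaussianVec (ι : Type*) [Fintype ι] (s : ℝ) : Measure (ι → ℂ) :=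
  Measure.pi (fun _ : ι => complexGaussian s)

/-! ### The antenna array and the sensing beam -/

/-- Response of a centred half-wavelength uniform linear array of `N` elements:
the entries are `exp (j π (m - (N - 1) / 2) x)`, `m = 0, …, N - 1`. -/
noncomputable def linearArray (N : ℕ) (x : ℝ) : Fin N → ℂ := fun m =>
  Complex.exp (((Real.pi * ((m : ℝ) - ((N : ℝ) - 1) / 2) * x : ℝ) : ℂ) * Complex.I)

/-- Transmit steering vector (Kronecker product of the horizontal and the vertical array
responses) of an `Nth × Ntv` uniform planar array, azimuth `θ`, elevation `φ`. -/
noncomputable def steering (Nth Ntv : ℕ) (θ φ : ℝ) : Fin Nth × Fin Ntv → ℂ := fun i =>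
  linearArray Nth (Real.sin θ * Real.sin φ) i.1 * linearArray Ntv (Real.cos φ) i.2

/-- Every steering vector is admissible as a sensing beam: its squared norm is the number of
antennas. -/
theorem steering_sq_norm (Nth Ntv : ℕ) (θ φ : ℝ) :
    ∑ i, ‖steering Nth Ntv θ φ i‖ ^ 2 = ((Nth * Ntv : ℕ) : ℝ) := by
  have h : ∀ i, ‖steering Nth Ntv θ φ i‖ = 1 := fun i => by
    simp only [steering, linearArray, norm_mul, Complex.norm_exp_ofReal_mul_I, mul_one]
  simp [h]

/-! ### System parameters -/

/-- Parameters of the downlink system with `K` single-antenna users. -/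
structure System (K : ℕ) where
  /-- length of the pilot sequences -/
  τp : ℕ
  /-- length of the coherence interval -/
  τc : ℕ
  /-- average power of the training symbols -/
  pp : ℝ
  /-- noise variance `σ_c²` -/
  σsq : ℝ
  /-- large-scale fading parameters -/
  β : Fin K → ℝ
  /-- pilot sequences -/
  pilot : Fin K → Fin τp → ℂ
  τp_pos : 0 < τp
  τp_lt : τp < τc
  pp_pos : 0 < pp
  σsq_pos : 0 < σsq
  β_pos : ∀ k, 0 < β k
  pilot_unit : ∀ k, ∑ t, ‖pilot k t‖ ^ 2 = 1

namespace System

variable {K : ℕ} (S : System K)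

/-- `ξ_k`, the variance of the entries of the MMSE estimate of the channel of user `k`. -/
noncomputable def ξ (k : Fin K) : ℝ :=
  (S.τp * S.pp * S.β k ^ 2) /
    (S.τp * S.pp * ∑ j, S.β j * ‖star (S.pilot j) ⬝ᵥ S.pilot k‖ ^ 2 + S.σsq)

/-- `ε_k = β_k - ξ_k`, the variance of the entries of the estimation error. -/
noncomputable def ε (k : Fin K) : ℝ := S.β k - S.ξ k

/-- The pre-log factor `(τ_c - τ_p) / τ_c`. -/
noncomputable def τbar : ℝ := ((S.τc : ℝ) - (S.τp : ℝ)) / (S.τc : ℝ)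

/-- The pilot sequences of distinct users are orthogonal. -/
def OrthogonalPilots : Prop := ∀ j k, j ≠ k → star (S.pilot j) ⬝ᵥ S.pilot k = 0

end System

/-! ### Channels and their estimates

The channels and estimates are random `ι × K` matrices (`ι` indexes the transmit antennas), whose
`k`-th columns are the channel `h_k` of user `k` and its estimate. -/

section Channel

variable {Ω ι : Type*} [MeasurableSpace Ω] [Fintype ι] {K : ℕ}

/-- Statistical description of Rayleigh fading with MMSE estimation: the estimates are independent
across users with laws `CN(0, ξ_k I)`, each estimation error `e_k = h_k - ĥ_k` has law
`CN(0, ε_k I)` and is independent of the estimates. -/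
structure EstimateStatistics (S : System K) (μ : Measure Ω)
    (H Hhat : Ω → Matrix ι (Fin K) ℂ) : Prop where
  law_estimate : ∀ k, HasLaw (fun ω i => Hhat ω i k) (complexGaussianVec ι (S.ξ k)) μ
  law_error : ∀ k, HasLaw (fun ω i => H ω i k - Hhat ω i k) (complexGaussianVec ι (S.ε k)) μ
  indep_estimate : iIndepFun (fun (k : Fin K) (ω : Ω) (i : ι) => Hhat ω i k) μ
  indep_error : ∀ k, IndepFun (fun ω i => H ω i k - Hhat ω i k)
    (fun (ω : Ω) (i : ι) (j : Fin K) => Hhat ω i j) μ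

/-- The signal received in uplink training, `√(τ_p p_p) ∑_j h_j p_jᴴ + N`, an `ι × τ_p` matrix. -/
noncomputable def trainingSignal (S : System K) (H : Ω → Matrix ι (Fin K) ℂ)
    (N : Ω → Matrix ι (Fin S.τp) ℂ) : Ω → ι → Fin S.τp → ℂ := fun ω i t =>
  (Real.sqrt (S.τp * S.pp) : ℂ) * ∑ j, H ω i j * star (S.pilot j t) + N ω i t

/-- Rayleigh fading, `h_k = √β_k h̄_k` with independent `h̄_k ~ CN(0, I)`, and MMSE estimation from
uplink training: the noise has independent `CN(0, σ_c²)` entries and is independent of the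
channels, and the estimate is the conditional expectation of the channel given the training
signal. -/
def IsTrainingMMSE (S : System K) (μ : Measure Ω) (H Hhat : Ω → Matrix ι (Fin K) ℂ) : Prop :=
  ∃ (Hbar : Ω → Matrix ι (Fin K) ℂ) (N : Ω → Matrix ι (Fin S.τp) ℂ),
    (∀ i k, Measurable fun ω => Hbar ω i k) ∧
    (∀ i t, Measurable fun ω => N ω i t) ∧
    (∀ ω i k, H ω i k = (Real.sqrt (S.β k) : ℂ) * Hbar ω i k) ∧
    (∀ k, HasLaw (fun ω i => Hbar ω i k) (complexGaussianVec ι 1) μ) ∧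
    iIndepFun (fun (k : Fin K) (ω : Ω) (i : ι) => Hbar ω i k) μ ∧
    (∀ t, HasLaw (fun ω i => N ω i t) (complexGaussianVec ι S.σsq) μ) ∧
    iIndepFun (fun (t : Fin S.τp) (ω : Ω) (i : ι) => N ω i t) μ ∧
    IndepFun (fun (ω : Ω) (i : ι) (k : Fin K) => Hbar ω i k)
      (fun (ω : Ω) (i : ι) (t : Fin S.τp) => N ω i t) μ ∧
    ∀ i k, (fun ω => Hhat ω i k) =ᵐ[μ]
      μ[fun ω => H ω i k | MeasurableSpace.comap (trainingSignal S H N) inferInstance]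

end Channel

/-! ### Precoding and achievable rate -/

/-- The two linear communications precoders: maximum ratio transmission and zero forcing. -/
inductive Precoder
  | MRT
  | ZF

section Precoding

variable {Ω ι : Type*} [MeasurableSpace Ω] [Fintype ι] {K : ℕ}

/-- The communications precoding matrix `W`: `Ĥ` for MRT, `Ĥ (Ĥᴴ Ĥ)⁻¹` for ZF. -/
noncomputable def Precoder.W (bf : Precoder) (Hhat : Matrix ι (Fin K) ℂ) :
    Matrix ι (Fin K) ℂ :=
  match bf with
  | .MRT => Hhat
  | .ZF => Hhat * (Hhatᴴ * Hhat)⁻¹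

/-- The overall precoder `F = W Γ + v η̄ᵀ`. -/
noncomputable def Precoder.F (bf : Precoder) (Hhat : Matrix ι (Fin K) ℂ) (v : ι → ℂ)
    (γ η : Fin K → ℝ) : Matrix ι (Fin K) ℂ :=
  bf.W Hhat * Matrix.diagonal (fun k => (Real.sqrt (γ k) : ℂ)) +
    Matrix.vecMulVec v (fun k => (Real.sqrt (η k) : ℂ))

/-- The effective gain `h_kᴴ f_j` of the stream of user `j` at user `k`. -/
noncomputable def gain (H F : Ω → Matrix ι (Fin K) ℂ) (k j : Fin K) (ω : Ω) : ℂ :=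
  ((H ω)ᴴ * F ω) k j

/-- The achievable rate of user `k`,
`τ̄ log₂ (1 + |DS_k|² / (E|BU_k|² + ∑_{j ≠ k} E|UI_kj|² + σ_c²))`, where `DS_k = E[h_kᴴ f_k]`,
`BU_k = h_kᴴ f_k - DS_k` and `UI_kj = h_kᴴ f_j`. -/
noncomputable def achievableRate (S : System K) (μ : Measure Ω)
    (H F : Ω → Matrix ι (Fin K) ℂ) (k : Fin K) : ℝ :=
  S.τbar * Real.logb 2 (1 + ‖∫ ω, gain H F k k ω ∂μ‖ ^ 2 /
    ((∫ ω, ‖gain H F k k ω - ∫ ω', gain H F k k ω' ∂μ‖ ^ 2 ∂μ) +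
      (∑ j ∈ Finset.univ.erase k, ∫ ω, ‖gain H F k j ω‖ ^ 2 ∂μ) + S.σsq))

/-- `λ_k` for `Nt` transmit antennas. -/
noncomputable def Precoder.lam (bf : Precoder) (S : System K) (Nt : ℕ) (k : Fin K) : ℝ :=
  match bf with
  | .MRT => (Nt : ℝ) ^ 2 * S.ξ k ^ 2
  | .ZF => 1

/-- The vector `ζ_k` for `Nt` transmit antennas. -/
noncomputable def Precoder.ζ (bf : Precoder) (S : System K) (Nt : ℕ) (k : Fin K) :
    Fin K → ℝ :=
  match bf with
  | .MRT => fun j => S.β k * S.ξ j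
  | .ZF => fun j => S.ε k / ((Nt : ℝ) * ((Nt : ℝ) - (K : ℝ))) * (1 / S.ξ j)

end Precoding

end ISAC

/-! Write `h_k = ĥ_k + e_k`. The error is independent of `Ĥ`, hence of every precoding vector, so in
`h_kᴴ f_j = ĥ_kᴴ f_j + e_kᴴ f_j` the second term has mean zero, is orthogonal to the first, and has
second moment `ε_k E‖f_j‖²` (`moments_add_inner_gaussian`). Only moments of functions of `Ĥ` remain.

Both precoders are odd functions of `Ĥ`, whose law is symmetric. Hence all cross terms between the
communications part and the beam `v` vanish (`integral_odd`). The beam contributes `η_j N_t (ξ_k +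
ε_k) = η_j N_t β_k`, the communications part `γ_j (E|ĥ_kᴴ w_j|² + ε_k E‖w_j‖²)`.

For MRT these are second and fourth Gaussian moments. For ZF, `ĥ_kᴴ w_j = δ_kj` almost surely, and
`‖w_j‖⁻²` is the squared distance from `ĥ_j` to the span of the other estimates
(`sum_norm_sq_zeroForcing`). Given those, it is the squared norm of a Gaussian vector in dimension
`N_t - K + 1`, and writing `1/r = ∫₀^∞ exp (-t r) dt` gives `E‖w_j‖² = 1 / (ξ_j (N_t - K))`.

The training description reduces to the statistical one (`IsTrainingMMSE.estimateStatistics`):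
estimate, error and training signal are linear images of one white Gaussian vector, for which
uncorrelated means independent. This is proved with characteristic functions. -/

namespace ISAC

/-! ### Complex Gaussian laws and their characteristic functions -/

/-- The character `z ↦ exp (j Re z)` of `ℂ`. -/
noncomputable def reChar (z : ℂ) : ℂ := Complex.exp ((z.re : ℂ) * Complex.I)

theorem reChar_add (z w : ℂ) : reChar (z + w) = reChar z * reChar w := by
  simp [reChar, add_mul, Complex.exp_add]

theorem reChar_sum {κ : Type*} (s : Finset κ) (f : κ → ℂ) :
    reChar (∑ a ∈ s, f a) = ∏ a ∈ s, reChar (f a) := by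
  simp [reChar, Finset.sum_mul, Complex.exp_sum]

theorem continuous_reChar : Continuous reChar := by
  unfold reChar; fun_prop

theorem measurable_mk_complex : Measurable (fun p : ℝ × ℝ => (⟨p.1, p.2⟩ : ℂ)) :=
  Complex.measurableEquivRealProd.symm.measurable

instance isProbabilityMeasure_complexGaussian (s : ℝ) :
    IsProbabilityMeasure (complexGaussian s) :=
  Measure.isProbabilityMeasure_map measurable_mk_complex.aemeasurable

instance isProbabilityMeasure_complexGaussianVec (ι : Type*) [Fintype ι] (s : ℝ) :
    IsProbabilityMeasure (complexGaussianVec ι s) := by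
  unfold complexGaussianVec; infer_instance

theorem integral_complexGaussian {E : Type*} [NormedAddCommGroup E] [NormedSpace ℝ E]
    (s : ℝ) (f : ℂ → E) :
    ∫ z, f z ∂complexGaussian s = ∫ p : ℝ × ℝ, f ⟨p.1, p.2⟩
      ∂((gaussianReal 0 (s / 2).toNNReal).prod (gaussianReal 0 (s / 2).toNNReal)) :=
  integral_map_equiv Complex.measurableEquivRealProd.symm f

/-- Since `Re (w z) = Re w · Re z - Im w · Im z`, the integral splits into two real Gaussian
characteristic functions of variance `s / 2`, whence the constant `s / 4`. -/
theorem integral_reChar_complexGaussian {s : ℝ} (hs : 0 ≤ s) (w : ℂ) :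
    ∫ z, reChar (w * z) ∂complexGaussian s = Complex.exp (-((s * ‖w‖ ^ 2 / 4 : ℝ) : ℂ)) := by
  have h : ∀ x : ℝ, ∫ y : ℝ, Complex.exp (((x * y : ℝ) : ℂ) * Complex.I)
      ∂gaussianReal 0 (s / 2).toNNReal = Complex.exp (-((s * x ^ 2 / 4 : ℝ) : ℂ)) := by
    intro x
    have := charFun_gaussianReal (μ := 0) (v := (s / 2).toNNReal) x
    rw [charFun_apply_real] at this
    simp only [Complex.ofReal_mul]
    rw [this]
    have h2 : (((s / 2).toNNReal : ℝ) : ℂ) = ((s / 2 : ℝ) : ℂ) := by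
      rw [Real.coe_toNNReal _ (by positivity)]
    rw [h2]
    congr 1
    push_cast
    ring
  rw [integral_complexGaussian]
  have h1 : ∀ p : ℝ × ℝ, reChar (w * ⟨p.1, p.2⟩) =
      Complex.exp (((w.re * p.1 : ℝ) : ℂ) * Complex.I) *
        Complex.exp (((-w.im * p.2 : ℝ) : ℂ) * Complex.I) := by
    intro p
    rw [reChar, ← Complex.exp_add]
    congr 1
    simp only [Complex.mul_re]
    push_cast
    ring
  simp_rw [h1]
  rw [integral_prod_mul (fun x : ℝ => Complex.exp (((w.re * x : ℝ) : ℂ) * Complex.I))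
    (fun x : ℝ => Complex.exp (((-w.im * x : ℝ) : ℂ) * Complex.I)), h, h, ← Complex.exp_add,
    ← Complex.normSq_eq_norm_sq, Complex.normSq_apply]
  congr 1
  push_cast
  ring

theorem integral_reChar_pi_complexGaussian {κ : Type*} [Fintype κ] {s : κ → ℝ}
    (hs : ∀ a, 0 ≤ s a) (w : κ → ℂ) :
    ∫ x, reChar (∑ a, w a * x a) ∂(Measure.pi fun a => complexGaussian (s a)) =
      Complex.exp (-((∑ a, s a * ‖w a‖ ^ 2 / 4 : ℝ) : ℂ)) := by
  simp_rw [reChar_sum]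
  rw [integral_fintype_prod_eq_prod (fun a z => reChar (w a * z))]
  simp_rw [integral_reChar_complexGaussian (hs _), ← Complex.exp_sum]
  simp

theorem integral_reChar_complexGaussianVec {κ : Type*} [Fintype κ] {s : ℝ}
    (hs : 0 ≤ s) (w : κ → ℂ) :
    ∫ x, reChar (∑ a, w a * x a) ∂complexGaussianVec κ s =
      Complex.exp (-((∑ a, s * ‖w a‖ ^ 2 / 4 : ℝ) : ℂ)) :=
  integral_reChar_pi_complexGaussian (s := fun _ => s) (fun _ => hs) w

/-! ### Characteristic functions of complex random vectors -/

/-- Every real functional on `ℂ^κ` is the real part of a complex linear form, so testing laws and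
independence against `reChar` of complex forms loses nothing. -/
theorem exists_coeff_of_dual {κ : Type*} [Fintype κ] (L : StrongDual ℝ (κ → ℂ)) :
    ∃ w : κ → ℂ, ∀ x, L x = (∑ a, w a * x a).re := by
  classical
  refine ⟨fun a => ⟨L (Pi.single a 1), - L (Pi.single a Complex.I)⟩, fun x => ?_⟩
  have hx : x = ∑ a, ((x a).re • (Pi.single a 1 : κ → ℂ) + (x a).im • (Pi.single a Complex.I : κ → ℂ)) := by
    ext b
    simp only [Finset.sum_apply, Pi.add_apply, Pi.smul_apply, Pi.single_apply]
    rw [Finset.sum_eq_single b]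
    · simp [Complex.re_add_im]
    · intro a _ hab; simp [hab.symm]
    · simp
  conv_lhs => rw [hx]
  simp only [map_sum, map_add, map_smul, smul_eq_mul, Complex.re_sum, Complex.mul_re]
  refine Finset.sum_congr rfl fun a _ => ?_
  ring

section CharFun

variable {Ω : Type*} [MeasurableSpace Ω] {μ : Measure Ω} {κ κ₁ κ₂ : Type*}
  [Fintype κ] [Fintype κ₁] [Fintype κ₂]

theorem charFunDual_map_eq_integral {E : Type*} [NormedAddCommGroup E] [NormedSpace ℝ E]
    [MeasurableSpace E] [BorelSpace E] {X : Ω → E} (hX : AEMeasurable X μ) (L : StrongDual ℝ E) :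
    charFunDual (μ.map X) L = ∫ ω, Complex.exp ((L (X ω) : ℂ) * Complex.I) ∂μ := by
  rw [charFunDual_apply, integral_map hX]
  exact Measurable.aestronglyMeasurable (by fun_prop)

theorem indepFun_of_integral_reChar [IsFiniteMeasure μ] {X : Ω → κ₁ → ℂ} {Y : Ω → κ₂ → ℂ}
    (hX : AEMeasurable X μ) (hY : AEMeasurable Y μ)
    (h : ∀ (u : κ₁ → ℂ) (v : κ₂ → ℂ), ∫ ω, reChar (∑ a, u a * X ω a + ∑ b, v b * Y ω b) ∂μ =
      (∫ ω, reChar (∑ a, u a * X ω a) ∂μ) * ∫ ω, reChar (∑ b, v b * Y ω b) ∂μ) :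
    IndepFun X Y μ := by
  rw [indepFun_iff_charFunDual_prod hX hY]
  intro L
  obtain ⟨u, hu⟩ := exists_coeff_of_dual (L.comp (.inl ℝ (κ₁ → ℂ) (κ₂ → ℂ)))
  obtain ⟨v, hv⟩ := exists_coeff_of_dual (L.comp (.inr ℝ (κ₁ → ℂ) (κ₂ → ℂ)))
  have hL : ∀ x y, L (x, y) = (∑ a, u a * x a + ∑ b, v b * y b).re := by
    intro x y
    rw [Complex.add_re, ← hu, ← hv]
    simp [← map_add]
  rw [charFunDual_map_eq_integral (hX.prodMk hY), charFunDual_map_eq_integral hX,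
    charFunDual_map_eq_integral hY]
  simp_rw [hL, hu, hv]
  exact h u v

theorem iIndepFun_of_integral_reChar [IsProbabilityMeasure μ] {X : κ₁ → Ω → κ₂ → ℂ}
    (hX : ∀ a, AEMeasurable (X a) μ)
    (h : ∀ u : κ₁ → κ₂ → ℂ, ∫ ω, reChar (∑ a, ∑ b, u a b * X a ω b) ∂μ =
      ∏ a, ∫ ω, reChar (∑ b, u a b * X a ω b) ∂μ) :
    iIndepFun X μ := by
  classical
  rw [iIndepFun_iff_charFunDual_pi hX]
  intro L
  choose u hu using fun a =>
    exists_coeff_of_dual (L.comp (.single ℝ (fun _ : κ₁ => κ₂ → ℂ) a))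
  have hL : ∀ x, L x = (∑ a, ∑ b, u a b * x a b).re := by
    intro x
    rw [Complex.re_sum]
    simp_rw [← hu]
    simp [← map_sum, LinearMap.sum_single_apply]
  rw [charFunDual_map_eq_integral (aemeasurable_pi_lambda _ hX)]
  simp_rw [charFunDual_map_eq_integral (hX _), hL, hu]
  exact h u

theorem hasLaw_of_integral_reChar [IsFiniteMeasure μ] {s : ℝ} (hs : 0 ≤ s) {X : Ω → κ → ℂ}
    (hX : AEMeasurable X μ)
    (h : ∀ u : κ → ℂ, ∫ ω, reChar (∑ a, u a * X ω a) ∂μ =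
      Complex.exp (-((∑ a, s * ‖u a‖ ^ 2 / 4 : ℝ) : ℂ))) :
    HasLaw X (complexGaussianVec κ s) μ := by
  refine ⟨hX, Measure.ext_of_charFunDual (funext fun L => ?_)⟩
  obtain ⟨u, hu⟩ := exists_coeff_of_dual L
  rw [charFunDual_map_eq_integral hX, charFunDual_apply]
  simp_rw [hu]
  exact (h u).trans (integral_reChar_complexGaussianVec hs u).symm

/-- The components of `X` are independent with laws `CN(0, s a)`, expressed through the
characteristic function of `X`. -/
structure IsWhite (X : Ω → κ → ℂ) (s : κ → ℝ) (μ : Measure Ω) : Prop where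
  aemeasurable : AEMeasurable X μ
  integral_reChar : ∀ w : κ → ℂ, ∫ ω, reChar (∑ a, w a * X ω a) ∂μ =
    Complex.exp (-((∑ a, s a * ‖w a‖ ^ 2 / 4 : ℝ) : ℂ))

theorem isWhite_of_hasLaw {s : ℝ} (hs : 0 ≤ s) {X : Ω → κ → ℂ}
    (hX : HasLaw X (complexGaussianVec κ s) μ) : IsWhite X (fun _ => s) μ := by
  refine ⟨hX.aemeasurable, fun w => ?_⟩
  rw [← integral_reChar_complexGaussianVec hs w]
  refine hX.integral_comp (f := fun x => reChar (∑ a, w a * x a)) ?_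
  have := continuous_reChar
  exact Continuous.aestronglyMeasurable (by fun_prop)

namespace IsWhite

variable {X : Ω → κ → ℂ} {s : κ → ℝ}

theorem aemeasurable_form (hX : IsWhite X s μ) (A : κ₁ → κ → ℂ) :
    AEMeasurable (fun ω m => ∑ a, A m a * X ω a) μ := by
  have h : Measurable (fun (x : κ → ℂ) m => ∑ a, A m a * x a) := by fun_prop
  exact h.comp_aemeasurable hX.aemeasurable

theorem integral_reChar_form (hX : IsWhite X s μ) (A : κ₁ → κ → ℂ) (u : κ₁ → ℂ) :
    ∫ ω, reChar (∑ m, u m * ∑ a, A m a * X ω a) ∂μ =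
      Complex.exp (-((∑ a, s a * ‖∑ m, u m * A m a‖ ^ 2 / 4 : ℝ) : ℂ)) := by
  rw [← hX.integral_reChar]
  congr 1
  ext ω
  congr 1
  simp_rw [Finset.mul_sum, Finset.sum_mul]
  rw [Finset.sum_comm]
  simp_rw [mul_assoc]

/-- Orthogonal linear forms in a white vector are again white. -/
theorem form [DecidableEq κ₁] (hX : IsWhite X s μ) {A : κ₁ → κ → ℂ} {r : κ₁ → ℝ}
    (hA : ∀ m n, ∑ a, (s a : ℂ) * (A m a * star (A n a)) = if m = n then (r m : ℂ) else 0) :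
    IsWhite (fun ω m => ∑ a, A m a * X ω a) r μ := by
  refine ⟨hX.aemeasurable_form A, fun u => ?_⟩
  rw [hX.integral_reChar_form]
  have key : ((∑ a, s a * ‖∑ m, u m * A m a‖ ^ 2 : ℝ) : ℂ) =
      ((∑ m, r m * ‖u m‖ ^ 2 : ℝ) : ℂ) := by
    have h1 : ∀ z : ℂ, (‖z‖ : ℂ) ^ 2 = z * star z := fun z => by
      rw [← Complex.mul_conj']; rfl
    push_cast
    simp_rw [h1, star_sum, Finset.sum_mul_sum, Finset.mul_sum, star_mul]
    rw [Finset.sum_comm]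
    refine Finset.sum_congr rfl fun m _ => ?_
    rw [Finset.sum_comm]
    have : ∀ n, ∑ a, (s a : ℂ) * (u m * A m a * (star (A n a) * star (u n))) =
        u m * star (u n) * if m = n then (r m : ℂ) else 0 := by
      intro n
      rw [← hA, Finset.mul_sum]
      exact Finset.sum_congr rfl fun a _ => by ring
    simp_rw [this]
    simp
    ring
  simp_rw [← Finset.sum_div]
  rw [Complex.ofReal_injective key]

theorem hasLaw [IsFiniteMeasure μ] {r : ℝ} (hr : 0 ≤ r) (hX : IsWhite X (fun _ => r) μ) :
    HasLaw X (complexGaussianVec κ r) μ :=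
  hasLaw_of_integral_reChar hr hX.aemeasurable hX.integral_reChar

/-- Uncorrelated linear forms in a white vector are independent. -/
theorem indepFun_form [IsFiniteMeasure μ] (hX : IsWhite X s μ) {A : κ₁ → κ → ℂ} {B : κ₂ → κ → ℂ}
    (hAB : ∀ m n, ∑ a, (s a : ℂ) * (A m a * star (B n a)) = 0) :
    IndepFun (fun ω m => ∑ a, A m a * X ω a) (fun ω n => ∑ a, B n a * X ω a) μ := by
  refine indepFun_of_integral_reChar (hX.aemeasurable_form A) (hX.aemeasurable_form B)
    fun u v => ?_
  rw [hX.integral_reChar_form, hX.integral_reChar_form]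
  -- Stacking the two families gives their joint characteristic function; it factors because the
  -- mixed term in the squared norm vanishes.
  have h := hX.integral_reChar_form (Sum.elim A B) (Sum.elim u v)
  simp only [Fintype.sum_sum_type, Sum.elim_inl, Sum.elim_inr] at h
  rw [h, ← Complex.exp_add]
  have hz : ∀ z w : ℂ, ‖z + w‖ ^ 2 = ‖z‖ ^ 2 + ‖w‖ ^ 2 + 2 * (z * star w).re := fun z w => by
    simp only [← Complex.normSq_eq_norm_sq]
    exact Complex.normSq_add z w
  have cross : ∑ a, (s a : ℂ) * ((∑ m, u m * A m a) * star (∑ n, v n * B n a)) = 0 := by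
    simp_rw [star_sum, Finset.sum_mul_sum, Finset.mul_sum, star_mul]
    rw [Finset.sum_comm]
    refine Finset.sum_eq_zero fun m _ => ?_
    rw [Finset.sum_comm]
    refine Finset.sum_eq_zero fun n _ => ?_
    have := congrArg (fun t => u m * star (v n) * t) (hAB m n)
    simp only [Finset.mul_sum, mul_zero] at this
    rw [← this]
    exact Finset.sum_congr rfl fun a _ => by ring
  have cross' := congrArg Complex.re cross
  simp only [Complex.re_sum, Complex.re_ofReal_mul, Complex.zero_re] at cross'
  rw [← neg_add, ← Complex.ofReal_add]
  congr 3
  simp_rw [hz, ← Finset.sum_div, mul_add, Finset.sum_add_distrib, mul_left_comm _ (2 : ℝ),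
    ← Finset.mul_sum, cross']
  ring

end IsWhite

end CharFun

/-! ### Moments of Gaussian laws -/

/-- The fourth derivative at `0` of the moment generating function `exp (v t² / 2)`. Each
differentiation keeps the form polynomial times `exp (v t² / 2)`, which `hp` records. -/
theorem integral_pow_four_gaussianReal (v : NNReal) :
    ∫ x, x ^ 4 ∂gaussianReal 0 v = 3 * (v : ℝ) ^ 2 := by
  have h0 : (0 : ℝ) ∈ interior (integrableExpSet (fun x : ℝ => x) (gaussianReal 0 v)) := by
    rw [integrableExpSet_fun_id_gaussianReal]; simp
  have h := iteratedDeriv_mgf_zero h0 4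
  simp only [Pi.pow_apply] at h
  rw [← h, mgf_fun_id_gaussianReal]
  simp only [zero_mul, zero_add]
  have hf : ∀ t : ℝ, HasDerivAt (fun t : ℝ => Real.exp ((v : ℝ) * t ^ 2 / 2))
      (v * t * Real.exp ((v : ℝ) * t ^ 2 / 2)) t := by
    intro t
    have := (((hasDerivAt_pow 2 t).const_mul (v : ℝ)).div_const 2).exp
    refine this.congr_deriv ?_
    push_cast
    ring
  have hp : ∀ p p' : ℝ → ℝ, (∀ t, HasDerivAt p (p' t) t) →
      deriv (fun t => p t * Real.exp ((v : ℝ) * t ^ 2 / 2)) =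
        fun t => (p' t + v * t * p t) * Real.exp ((v : ℝ) * t ^ 2 / 2) := by
    intro p p' h
    funext t
    rw [((h t).fun_mul (hf t)).deriv]
    ring
  have e1 : deriv (fun t : ℝ => Real.exp ((v : ℝ) * t ^ 2 / 2)) =
      fun t => (v * t) * Real.exp ((v : ℝ) * t ^ 2 / 2) := funext fun t => (hf t).deriv
  have d1 : ∀ t : ℝ, HasDerivAt (fun t : ℝ => (v : ℝ) * t) v t := fun t => by
    simpa using (hasDerivAt_id t).const_mul (v : ℝ)
  have e2 := hp _ _ d1
  have d2 : ∀ t : ℝ, HasDerivAt (fun t : ℝ => (v : ℝ) + v * t * (v * t)) (2 * v ^ 2 * t) t :=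
    fun t => (((d1 t).mul (d1 t)).const_add (v : ℝ)).congr_deriv (by ring)
  have e3 := hp _ _ d2
  have d3 : ∀ t : ℝ, HasDerivAt (fun t : ℝ => 2 * (v : ℝ) ^ 2 * t + v * t * (v + v * t * (v * t)))
      (2 * v ^ 2 + v * (v + v * t * (v * t)) + v * t * (2 * v ^ 2 * t)) t := fun t => by
    refine (((hasDerivAt_id t).const_mul (2 * (v : ℝ) ^ 2)).add
      ((d1 t).mul (d2 t))).congr_deriv ?_
    ring
  have e4 := hp _ _ d3
  rw [iteratedDeriv_succ, iteratedDeriv_succ, iteratedDeriv_succ, iteratedDeriv_one, e1, e2, e3, e4]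
  simp
  ring

theorem memLp_id_complexGaussian (s : ℝ) (p : ENNReal) (hp : p ≠ ⊤) :
    MemLp (fun z : ℂ => z) p (complexGaussian s) := by
  have h := memLp_id_gaussianReal' (μ := 0) (v := (s / 2).toNNReal) p hp
  rw [complexGaussian, memLp_map_measure_iff (f := fun p : ℝ × ℝ => (⟨p.1, p.2⟩ : ℂ))
    (g := fun z : ℂ => z) aestronglyMeasurable_id measurable_mk_complex.aemeasurable]
  have h1 := h.comp_fst (gaussianReal 0 (s / 2).toNNReal)
  have h2 := h.comp_snd (gaussianReal 0 (s / 2).toNNReal)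
  have h3 := h1.ofReal (K := ℂ).add (h2.ofReal (K := ℂ).mul_const Complex.I)
  refine h3.congr_norm (measurable_mk_complex.aestronglyMeasurable) ?_
  refine Filter.Eventually.of_forall fun p => ?_
  simp [Complex.mk_eq_add_mul_I]

theorem integral_id_complexGaussian (s : ℝ) : ∫ z, z ∂complexGaussian s = 0 := by
  have h := memLp_id_gaussianReal' (μ := 0) (v := (s / 2).toNNReal) 1 (by simp)
  have h1 := (h.comp_fst (gaussianReal 0 (s / 2).toNNReal)).integrable le_rfl
  have h2 := (h.comp_snd (gaussianReal 0 (s / 2).toNNReal)).integrable le_rfl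
  rw [integral_complexGaussian]
  simp_rw [Complex.mk_eq_add_mul_I]
  rw [integral_add h1.ofReal (h2.ofReal.mul_const _), integral_mul_const, integral_complex_ofReal,
    integral_complex_ofReal, integral_fun_fst (fun x : ℝ => x), integral_fun_snd (fun x : ℝ => x)]
  simp

theorem integral_sq_gaussianReal (v : NNReal) : ∫ x, x ^ 2 ∂gaussianReal 0 v = v := by
  have h := variance_fun_id_gaussianReal (μ := 0) (v := v)
  rwa [variance_of_integral_eq_zero aemeasurable_id' (by simp)] at h

theorem integral_norm_sq_complexGaussian {s : ℝ} (hs : 0 ≤ s) :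
    ∫ z, ‖z‖ ^ 2 ∂complexGaussian s = s := by
  have h := memLp_id_gaussianReal' (μ := 0) (v := (s / 2).toNNReal) 2 (by simp)
  have h1 := (h.comp_fst (gaussianReal 0 (s / 2).toNNReal)).integrable_sq
  have h2 := (h.comp_snd (gaussianReal 0 (s / 2).toNNReal)).integrable_sq
  rw [integral_complexGaussian]
  simp_rw [← Complex.normSq_eq_norm_sq, Complex.normSq_apply, ← pow_two]
  simp only [id] at h1 h2
  rw [integral_add h1 h2, integral_fun_fst (fun x : ℝ => x ^ 2),
    integral_fun_snd (fun x : ℝ => x ^ 2), integral_sq_gaussianReal,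
    Real.coe_toNNReal _ (by positivity)]
  simp

theorem integral_norm_pow_four_complexGaussian {s : ℝ} (hs : 0 ≤ s) :
    ∫ z, ‖z‖ ^ 4 ∂complexGaussian s = 2 * s ^ 2 := by
  have h := memLp_id_gaussianReal' (μ := 0) (v := (s / 2).toNNReal) 4 (by simp)
  have h' := memLp_id_gaussianReal' (μ := 0) (v := (s / 2).toNNReal) 2 (by simp)
  have h1 := (h.comp_fst (gaussianReal 0 (s / 2).toNNReal)).integrable_norm_pow (p := 4) (by simp)
  have h2 := (h.comp_snd (gaussianReal 0 (s / 2).toNNReal)).integrable_norm_pow (p := 4) (by simp)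
  have h3 := h'.integrable_sq.mul_prod h'.integrable_sq
  rw [integral_complexGaussian]
  have e : ∀ p : ℝ × ℝ, ‖(⟨p.1, p.2⟩ : ℂ)‖ ^ 4 = p.1 ^ 4 + p.2 ^ 4 + 2 * (p.1 ^ 2 * p.2 ^ 2) := by
    intro p
    rw [show ‖(⟨p.1, p.2⟩ : ℂ)‖ ^ 4 = (‖(⟨p.1, p.2⟩ : ℂ)‖ ^ 2) ^ 2 by ring,
      ← Complex.normSq_eq_norm_sq, Complex.normSq_apply]
    ring
  simp_rw [e]
  have hn : ∀ x : ℝ, ‖x‖ ^ 4 = x ^ 4 := fun x => by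
    rw [Real.norm_eq_abs]; exact Even.pow_abs (by decide) x
  simp only [id, hn] at h1 h2 h3
  rw [integral_add (by exact h1.add h2) (h3.const_mul 2), integral_add h1 h2, integral_const_mul,
    integral_prod_mul (fun x : ℝ => x ^ 2) (fun x : ℝ => x ^ 2),
    integral_fun_fst (fun x : ℝ => x ^ 4), integral_fun_snd (fun x : ℝ => x ^ 4),
    integral_sq_gaussianReal, integral_pow_four_gaussianReal, Real.coe_toNNReal _ (by positivity)]
  simp
  ring

theorem complexGaussian_map_neg {s : ℝ} : (complexGaussian s).map (fun z => -z) =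
    complexGaussian s := by
  have hg : (gaussianReal 0 (s / 2).toNNReal).map (fun x => -x) =
      gaussianReal 0 (s / 2).toNNReal := by rw [gaussianReal_map_neg, neg_zero]
  rw [complexGaussian, Measure.map_map measurable_neg measurable_mk_complex]
  conv_rhs => rw [← hg, Measure.map_prod_map _ _ measurable_neg measurable_neg,
    Measure.map_map measurable_mk_complex (by fun_prop)]
  congr 1

section Vec

variable {Ω ι : Type*} [MeasurableSpace Ω] {μ : Measure Ω} [Fintype ι] {s : ℝ} {e : Ω → ι → ℂ}

theorem hasLaw_eval_complexGaussianVec (he : HasLaw e (complexGaussianVec ι s) μ) (i : ι) :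
    HasLaw (fun ω => e ω i) (complexGaussian s) μ :=
  (measurePreserving_eval (fun _ : ι => complexGaussian s) i).hasLaw.fun_comp he

theorem memLp_of_hasLaw_complexGaussianVec (he : HasLaw e (complexGaussianVec ι s) μ) (i : ι)
    {p : ENNReal} (hp : p ≠ ⊤) : MemLp (fun ω => e ω i) p μ := by
  have h := hasLaw_eval_complexGaussianVec he i
  have h2 := memLp_id_complexGaussian s p hp
  rw [← h.map_eq] at h2
  exact h2.comp_of_map h.aemeasurable

theorem integral_eval_complexGaussianVec (he : HasLaw e (complexGaussianVec ι s) μ) (i : ι) :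
    ∫ ω, e ω i ∂μ = 0 := by
  rw [(hasLaw_eval_complexGaussianVec he i).integral_eq, integral_id_complexGaussian]

theorem integral_norm_sq_eval_complexGaussianVec (hs : 0 ≤ s)
    (he : HasLaw e (complexGaussianVec ι s) μ) (i : ι) : ∫ ω, ‖e ω i‖ ^ 2 ∂μ = s := by
  rw [← integral_norm_sq_complexGaussian hs]
  exact (hasLaw_eval_complexGaussianVec he i).integral_comp (f := fun z => ‖z‖ ^ 2)
    (Continuous.aestronglyMeasurable (by fun_prop))

theorem integral_norm_pow_four_eval_complexGaussianVec (hs : 0 ≤ s)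
    (he : HasLaw e (complexGaussianVec ι s) μ) (i : ι) : ∫ ω, ‖e ω i‖ ^ 4 ∂μ = 2 * s ^ 2 := by
  rw [← integral_norm_pow_four_complexGaussian hs]
  exact (hasLaw_eval_complexGaussianVec he i).integral_comp (f := fun z => ‖z‖ ^ 4)
    (Continuous.aestronglyMeasurable (by fun_prop))

theorem iIndepFun_eval_complexGaussianVec [IsProbabilityMeasure μ]
    (he : HasLaw e (complexGaussianVec ι s) μ) : iIndepFun (fun i ω => e ω i) μ :=
  (iIndepFun_iff_hasLaw_pi_pi (hasLaw_eval_complexGaussianVec he)).2 he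

theorem integral_star_mul_eval_complexGaussianVec [IsProbabilityMeasure μ]
    (he : HasLaw e (complexGaussianVec ι s) μ) {i l : ι} (hil : i ≠ l) :
    ∫ ω, star (e ω i) * e ω l ∂μ = 0 := by
  have h := ((iIndepFun_eval_complexGaussianVec he).indepFun hil).comp
    (continuous_star (R := ℂ)).measurable measurable_id
  have h1 := h.integral_fun_mul_eq_mul_integral
    (continuous_star.comp_aestronglyMeasurable
      (memLp_of_hasLaw_complexGaussianVec he i (p := 2) (by simp)).1)
    (memLp_of_hasLaw_complexGaussianVec he l (p := 2) (by simp)).1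
  simp only [Function.comp, id] at h1
  rw [h1, integral_eval_complexGaussianVec he l, mul_zero]

end Vec

/-! ### Second moments -/

section SecondMoment

variable {Ω ι : Type*} [MeasurableSpace Ω] {μ : Measure Ω}

theorem integrable_mul_star {X Y : Ω → ℂ} (hX : MemLp X 2 μ) (hY : MemLp Y 2 μ) :
    Integrable (fun ω => X ω * star (Y ω)) μ :=
  hX.integrable_mul hY.star

theorem integral_norm_sq_add_of_orthogonal {X Y : Ω → ℂ} (hX : MemLp X 2 μ) (hY : MemLp Y 2 μ)
    (h : ∫ ω, X ω * star (Y ω) ∂μ = 0) :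
    ∫ ω, ‖X ω + Y ω‖ ^ 2 ∂μ = ∫ ω, ‖X ω‖ ^ 2 ∂μ + ∫ ω, ‖Y ω‖ ^ 2 ∂μ := by
  have hz : ∀ z w : ℂ, ‖z + w‖ ^ 2 = ‖z‖ ^ 2 + ‖w‖ ^ 2 + 2 * (z * star w).re := fun z w => by
    simp only [← Complex.normSq_eq_norm_sq]
    exact Complex.normSq_add z w
  simp_rw [hz]
  have hi := integrable_mul_star hX hY
  have h1 := (memLp_two_iff_integrable_sq_norm hX.1).1 hX
  have h2 := (memLp_two_iff_integrable_sq_norm hY.1).1 hY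
  have hre : ∫ ω, (X ω * star (Y ω)).re ∂μ = 0 := by
    have := integral_re (𝕜 := ℂ) hi
    rw [h] at this
    simpa using this
  have hir : Integrable (fun ω => (X ω * star (Y ω)).re) μ := hi.re
  rw [integral_add (by exact h1.add h2) (hir.const_mul 2), integral_add h1 h2,
    integral_const_mul, hre]
  ring

theorem integral_norm_sq_sum_of_orthogonal {X : ι → Ω → ℂ} (hX : ∀ i, MemLp (X i) 2 μ)
    (h : ∀ i l, i ≠ l → ∫ ω, X i ω * star (X l ω) ∂μ = 0) (t : Finset ι) :
    ∫ ω, ‖∑ i ∈ t, X i ω‖ ^ 2 ∂μ = ∑ i ∈ t, ∫ ω, ‖X i ω‖ ^ 2 ∂μ := by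
  classical
  induction t using Finset.induction_on with
  | empty => simp
  | insert a t ha ih =>
    simp only [Finset.sum_insert ha]
    rw [integral_norm_sq_add_of_orthogonal (hX a) (memLp_finsetSum t fun i _ => hX i), ih]
    simp only [star_sum, Finset.mul_sum]
    rw [integral_finsetSum _ fun i _ => integrable_mul_star (hX a) (hX i)]
    exact Finset.sum_eq_zero fun i hi => h a i (by rintro rfl; exact ha hi)

/-- Integrating out a Gaussian vector `e` independent of `f` and `a`. -/
theorem moments_add_inner_gaussian [Fintype ι] [IsProbabilityMeasure μ] {s : ℝ} (hs : 0 ≤ s)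
    {e f : Ω → ι → ℂ} {a : Ω → ℂ} (he : HasLaw e (complexGaussianVec ι s) μ)
    (hind : IndepFun e (fun ω => (f ω, a ω)) μ) (hf : ∀ i, MemLp (fun ω => f ω i) 2 μ)
    (ha : MemLp a 2 μ) :
    MemLp (fun ω => a ω + ∑ i, star (e ω i) * f ω i) 2 μ ∧
    ∫ ω, (a ω + ∑ i, star (e ω i) * f ω i) ∂μ = ∫ ω, a ω ∂μ ∧
    ∫ ω, ‖a ω + ∑ i, star (e ω i) * f ω i‖ ^ 2 ∂μ =
      ∫ ω, ‖a ω‖ ^ 2 ∂μ + s * ∑ i, ∫ ω, ‖f ω i‖ ^ 2 ∂μ := by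
  have heL : ∀ i, MemLp (fun ω => e ω i) 2 μ :=
    fun i => memLp_of_hasLaw_complexGaussianVec he i (by simp)
  -- Hölder would only give an integrable product; independence makes the product of the squared
  -- norms integrable.
  have hL : ∀ i, MemLp (fun ω => star (e ω i) * f ω i) 2 μ := by
    intro i
    rw [memLp_two_iff_integrable_sq_norm (by exact (heL i).star.1.mul (hf i).1)]
    have hi : IndepFun (fun ω => ‖e ω i‖ ^ 2) (fun ω => ‖f ω i‖ ^ 2) μ :=
      hind.comp (φ := fun x : ι → ℂ => ‖x i‖ ^ 2) (ψ := fun y : (ι → ℂ) × ℂ => ‖y.1 i‖ ^ 2) (by fun_prop) (by fun_prop)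
    have := hi.integrable_mul ((memLp_two_iff_integrable_sq_norm (heL i).1).1 (heL i))
      ((memLp_two_iff_integrable_sq_norm (hf i).1).1 (hf i))
    refine this.congr (Filter.Eventually.of_forall fun ω => ?_)
    simp [mul_pow]
  have hmean : ∀ i, ∫ ω, star (e ω i) * f ω i ∂μ = 0 := by
    intro i
    have hi : IndepFun (fun ω => star (e ω i)) (fun ω => f ω i) μ :=
      hind.comp (φ := fun x : ι → ℂ => star (x i)) (ψ := fun y : (ι → ℂ) × ℂ => y.1 i)
        (Continuous.measurable (by fun_prop)) (by fun_prop)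
    rw [hi.integral_fun_mul_eq_mul_integral (heL i).star.1 (hf i).1]
    have : ∫ ω, star (e ω i) ∂μ = 0 := by
      have h := integral_conj (μ := μ) (f := fun ω => e ω i)
      rw [integral_eval_complexGaussianVec he i, map_zero] at h
      exact h
    rw [this, zero_mul]
  have hsum := memLp_finsetSum Finset.univ fun i _ => hL i
  have horth : ∀ i l, i ≠ l → ∫ ω, (star (e ω i) * f ω i) * star (star (e ω l) * f ω l) ∂μ = 0 := by
    intro i l hil
    have hi : IndepFun (fun ω => star (e ω i) * e ω l) (fun ω => f ω i * star (f ω l)) μ :=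
      hind.comp (φ := fun x : ι → ℂ => star (x i) * x l) (ψ := fun y : (ι → ℂ) × ℂ => y.1 i * star (y.1 l))
        (Continuous.measurable (by fun_prop)) (Continuous.measurable (by fun_prop))
    have := hi.integral_fun_mul_eq_mul_integral ((heL i).star.1.mul (heL l).1)
      ((hf i).1.mul (hf l).star.1)
    rw [integral_star_mul_eval_complexGaussianVec he hil, zero_mul] at this
    rw [← this]
    congr 1
    ext ω
    rw [star_mul, star_star]
    ring
  have hcross : ∫ ω, a ω * star (∑ i, star (e ω i) * f ω i) ∂μ = 0 := by
    simp only [star_sum, Finset.mul_sum]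
    rw [integral_finsetSum _ fun i _ => integrable_mul_star ha (hL i)]
    refine Finset.sum_eq_zero fun i _ => ?_
    have hi : IndepFun (fun ω => e ω i) (fun ω => a ω * star (f ω i)) μ :=
      hind.comp (φ := fun x : ι → ℂ => x i) (ψ := fun y : (ι → ℂ) × ℂ => y.2 * star (y.1 i))
        (by fun_prop) (Continuous.measurable (by fun_prop))
    have := hi.integral_fun_mul_eq_mul_integral (heL i).1 (ha.1.mul (hf i).star.1)
    rw [integral_eval_complexGaussianVec he i, zero_mul] at this
    rw [← this]
    congr 1
    ext ω
    rw [star_mul, star_star]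
    ring
  refine ⟨ha.add hsum, ?_, ?_⟩
  · rw [integral_add (ha.integrable (by norm_num)) (hsum.integrable (by norm_num)),
      integral_finsetSum _ fun i _ => (hL i).integrable (by norm_num)]
    rw [Finset.sum_eq_zero fun i _ => hmean i, add_zero]
  · rw [integral_norm_sq_add_of_orthogonal ha hsum hcross,
      integral_norm_sq_sum_of_orthogonal hL horth, Finset.mul_sum]
    congr 1
    refine Finset.sum_congr rfl fun i _ => ?_
    have hi : IndepFun (fun ω => ‖e ω i‖ ^ 2) (fun ω => ‖f ω i‖ ^ 2) μ :=
      hind.comp (φ := fun x : ι → ℂ => ‖x i‖ ^ 2) (ψ := fun y : (ι → ℂ) × ℂ => ‖y.1 i‖ ^ 2) (by fun_prop) (by fun_prop)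
    rw [← integral_norm_sq_eval_complexGaussianVec hs he i,
      ← hi.integral_fun_mul_eq_mul_integral ((heL i).1.norm.pow 2) ((hf i).1.norm.pow 2)]
    simp [mul_pow]

end SecondMoment

/-! ### Linear combinations of independent Gaussian vectors -/

section Blocks

variable {Ω : Type*} [MeasurableSpace Ω] {μ : Measure Ω} {κ κ₁ κ₂ ι : Type*}
  [Fintype κ] [Fintype κ₁] [Fintype κ₂] [Fintype ι]

theorem integral_reChar_blocks [IsProbabilityMeasure μ] {r : ℝ} (hr : 0 ≤ r) {X : κ → Ω → ι → ℂ}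
    (hX : ∀ x, HasLaw (X x) (complexGaussianVec ι r) μ) (hind : iIndepFun X μ)
    (w : κ → ι → ℂ) :
    ∫ ω, reChar (∑ x, ∑ i, w x i * X x ω i) ∂μ =
      Complex.exp (-((∑ x, ∑ i, r * ‖w x i‖ ^ 2 / 4 : ℝ) : ℂ)) := by
  have hc := continuous_reChar
  simp_rw [reChar_sum Finset.univ (fun x => ∑ i, w x i * X x _ i)]
  rw [hind.integral_fun_prod_comp (f := fun x y => reChar (∑ i, w x i * y i))
    (fun x => (hX x).aemeasurable) (fun x => Continuous.aestronglyMeasurable (by fun_prop))]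
  simp_rw [fun x => (isWhite_of_hasLaw hr (hX x)).integral_reChar (w x), ← Complex.exp_sum]
  simp

/-- Merges fading and noise, which have different variances, into one white vector; this is why the
variance in `IsWhite` depends on the index. -/
theorem isWhite_sum_blocks [IsProbabilityMeasure μ] {r₁ r₂ : ℝ} (hr₁ : 0 ≤ r₁) (hr₂ : 0 ≤ r₂)
    {X : κ₁ → Ω → ι → ℂ} {Y : κ₂ → Ω → ι → ℂ}
    (hX : ∀ x, HasLaw (X x) (complexGaussianVec ι r₁) μ) (hXi : iIndepFun X μ)
    (hY : ∀ y, HasLaw (Y y) (complexGaussianVec ι r₂) μ) (hYi : iIndepFun Y μ)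
    (hXY : IndepFun (fun ω x => X x ω) (fun ω y => Y y ω) μ) :
    IsWhite (fun ω (p : (κ₁ ⊕ κ₂) × ι) => Sum.elim X Y p.1 ω p.2)
      (fun p => Sum.elim (fun _ => r₁) (fun _ => r₂) p.1) μ := by
  refine ⟨aemeasurable_pi_lambda _ fun p => ?_, fun w => ?_⟩
  · rcases p with ⟨x | y, i⟩
    · exact (measurable_pi_apply i).comp_aemeasurable (hX x).aemeasurable
    · exact (measurable_pi_apply i).comp_aemeasurable (hY y).aemeasurable
  · have hc := continuous_reChar
    simp only [Fintype.sum_prod_type, Fintype.sum_sum_type, Sum.elim_inl, Sum.elim_inr, reChar_add]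
    have hi := hXY.comp
      (φ := fun X : κ₁ → ι → ℂ => reChar (∑ x, ∑ i, w (Sum.inl x, i) * X x i))
      (ψ := fun Y : κ₂ → ι → ℂ => reChar (∑ y, ∑ i, w (Sum.inr y, i) * Y y i))
      (Continuous.measurable (by fun_prop)) (Continuous.measurable (by fun_prop))
    have hXm : AEMeasurable (fun ω x => X x ω) μ :=
      aemeasurable_pi_lambda _ fun x => (hX x).aemeasurable
    have hYm : AEMeasurable (fun ω y => Y y ω) μ :=
      aemeasurable_pi_lambda _ fun y => (hY y).aemeasurable
    have := hi.integral_fun_mul_eq_mul_integral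
      ((Continuous.measurable (by fun_prop)).comp_aemeasurable hXm).aestronglyMeasurable
      ((Continuous.measurable (by fun_prop)).comp_aemeasurable hYm).aestronglyMeasurable
    refine this.trans ?_
    simp only [Function.comp]
    rw [integral_reChar_blocks hr₁ hX hXi (fun x i => w (Sum.inl x, i)),
      integral_reChar_blocks hr₂ hY hYi (fun x i => w (Sum.inr x, i)), ← Complex.exp_add,
      ← neg_add, ← Complex.ofReal_add]

variable {X : κ → Ω → ι → ℂ} {s : κ → ℝ}

/-- Kronecker coefficients turn a combination of whole blocks into scalar forms, to which the
results on `IsWhite` apply; orthogonality then reduces to the block coefficients. -/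
theorem sum_blocks_eq_form [DecidableEq ι] (q : κ → ℂ) (X : κ → ι → ℂ) (i : ι) :
    ∑ x, q x * X x i = ∑ p : κ × ι, (if i = p.2 then q p.1 else 0) * X p.1 p.2 := by
  simp [Fintype.sum_prod_type]

theorem sum_blocks_mul_star [DecidableEq ι] (q r : κ → ℂ) (m n : ι) :
    ∑ p : κ × ι, (s p.1 : ℂ) * ((if m = p.2 then q p.1 else 0) *
      star (if n = p.2 then r p.1 else 0)) =
    if m = n then ∑ x, (s x : ℂ) * (q x * star (r x)) else 0 := by
  by_cases h : m = n
  · subst h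
    simp [Fintype.sum_prod_type, apply_ite]
  · rw [if_neg h]
    refine Finset.sum_eq_zero fun p _ => ?_
    by_cases h1 : m = p.2
    · rw [if_neg (fun h2 : n = p.2 => h (h1.trans h2.symm))]; simp
    · rw [if_neg h1]; simp

theorem hasLaw_sum_blocks [IsFiniteMeasure μ]
    (hX : IsWhite (fun ω (p : κ × ι) => X p.1 ω p.2) (fun p => s p.1) μ)
    {q : κ → ℂ} {r : ℝ} (hr : 0 ≤ r) (hq : ∑ x, (s x : ℂ) * (q x * star (q x)) = r) :
    HasLaw (fun ω i => ∑ x, q x * X x ω i) (complexGaussianVec ι r) μ := by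
  classical
  simp_rw [fun ω i => sum_blocks_eq_form q (fun x => X x ω) i]
  refine (hX.form (r := fun _ => r) fun m n => ?_).hasLaw hr
  rw [sum_blocks_mul_star (s := s) q q m n, hq]

theorem indepFun_sum_blocks [IsFiniteMeasure μ]
    (hX : IsWhite (fun ω (p : κ × ι) => X p.1 ω p.2) (fun p => s p.1) μ)
    {q : κ → ℂ} {r : κ₂ → κ → ℂ} (hq : ∀ t, ∑ x, (s x : ℂ) * (q x * star (r t x)) = 0) :
    IndepFun (fun ω i => ∑ x, q x * X x ω i) (fun ω i t => ∑ x, r t x * X x ω i) μ := by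
  classical
  have h := hX.indepFun_form (A := fun i (p : κ × ι) => if i = p.2 then q p.1 else 0)
    (B := fun (it : ι × κ₂) (p : κ × ι) => if it.1 = p.2 then r it.2 p.1 else 0) fun m n => by
      rw [sum_blocks_mul_star (s := s) q (r n.2) m n.1, hq]; simp
  have h2 := h.comp measurable_id (ψ := fun y : ι × κ₂ → ℂ => fun i t => y (i, t)) (by fun_prop)
  refine h2.congr (Filter.Eventually.of_forall fun ω => ?_)
    (Filter.Eventually.of_forall fun ω => ?_)
  · ext i
    exact (sum_blocks_eq_form q (fun x => X x ω) i).symm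
  · ext i t
    exact (sum_blocks_eq_form (r t) (fun x => X x ω) i).symm

theorem iIndepFun_sum_blocks [IsProbabilityMeasure μ]
    (hX : IsWhite (fun ω (p : κ × ι) => X p.1 ω p.2) (fun p => s p.1) μ)
    {q : κ₁ → κ → ℂ} {r : κ₁ → ℝ} (hr : ∀ m, 0 ≤ r m)
    (hqd : ∀ m, ∑ x, (s x : ℂ) * (q m x * star (q m x)) = r m)
    (hqo : ∀ m n, m ≠ n → ∑ x, (s x : ℂ) * (q m x * star (q n x)) = 0) :
    iIndepFun (fun m ω i => ∑ x, q m x * X x ω i) μ := by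
  classical
  have hlaw := fun m => hasLaw_sum_blocks hX (hr m) (hqd m)
  refine iIndepFun_of_integral_reChar (fun m => (hlaw m).aemeasurable) fun u => ?_
  have h := hX.form (A := fun (mi : κ₁ × ι) (p : κ × ι) => if mi.2 = p.2 then q mi.1 p.1 else 0)
    (r := fun mi => r mi.1) fun m n => by
      rw [sum_blocks_mul_star (s := s) (q m.1) (q n.1) m.2 n.2]
      by_cases h1 : m.1 = n.1
      · by_cases h2 : m.2 = n.2
        · rw [if_pos h2, if_pos (Prod.ext h1 h2), ← h1, hqd]
        · rw [if_neg h2, if_neg (fun h => h2 (congrArg Prod.snd h))]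
      · rw [hqo _ _ h1, ite_self, if_neg (fun h => h1 (congrArg Prod.fst h))]
  have h2 := h.integral_reChar (fun p => u p.1 p.2)
  simp_rw [fun ω (mi : κ₁ × ι) =>
    (sum_blocks_eq_form (q mi.1) (fun x => X x ω) mi.2).symm, Fintype.sum_prod_type] at h2
  rw [h2]
  simp_rw [fun m => (isWhite_of_hasLaw (hr m) (hlaw m)).integral_reChar (u m), ← Complex.exp_sum]
  simp

end Blocks

/-! ### MMSE estimation from uplink training -/

section Training

variable {Ω ι : Type*} [MeasurableSpace Ω] {μ : Measure Ω} [Fintype ι] {K : ℕ} (S : System K)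

namespace System

theorem ξ_denom_pos (k : Fin K) :
    0 < S.τp * S.pp * ∑ j, S.β j * ‖star (S.pilot j) ⬝ᵥ S.pilot k‖ ^ 2 + S.σsq := by
  have h1 := S.pp_pos
  have h2 := S.σsq_pos
  have h3 := S.β_pos
  have : 0 ≤ ∑ j, S.β j * ‖star (S.pilot j) ⬝ᵥ S.pilot k‖ ^ 2 :=
    Finset.sum_nonneg fun j _ => mul_nonneg (h3 j).le (by positivity)
  positivity

theorem ξ_pos (k : Fin K) : 0 < S.ξ k := by
  have h0 : (0 : ℝ) < S.τp := by exact_mod_cast S.τp_pos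
  have h1 := S.pp_pos
  have h3 := S.β_pos k
  exact div_pos (by positivity) (S.ξ_denom_pos k)

theorem star_pilot_dotProduct_self (k : Fin K) : star (S.pilot k) ⬝ᵥ S.pilot k = 1 := by
  have h := congrArg (fun x : ℝ => (x : ℂ)) (S.pilot_unit k)
  simp only [Complex.ofReal_sum, Complex.ofReal_pow, Complex.ofReal_one] at h
  rw [← h]
  refine Finset.sum_congr rfl fun t _ => ?_
  rw [← Complex.conj_mul']
  rfl

/-- The summand `j = k` alone contributes `β_k` to the sum in the denominator of `ξ_k`, because the
pilot has unit norm; hence `ξ_k ≤ β_k`. -/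
theorem ε_nonneg (k : Fin K) : 0 ≤ S.ε k := by
  have h0 : (0 : ℝ) < S.τp := by exact_mod_cast S.τp_pos
  have h1 := S.pp_pos
  have h2 := S.σsq_pos
  have h3 := S.β_pos
  rw [ε, sub_nonneg, ξ, div_le_iff₀ (S.ξ_denom_pos k)]
  have : S.β k ≤ ∑ j, S.β j * ‖star (S.pilot j) ⬝ᵥ S.pilot k‖ ^ 2 := by
    have := Finset.single_le_sum (f := fun j => S.β j * ‖star (S.pilot j) ⬝ᵥ S.pilot k‖ ^ 2)
      (fun j _ => mul_nonneg (h3 j).le (by positivity)) (Finset.mem_univ k)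
    simpa [star_pilot_dotProduct_self] using this
  have h4 : S.τp * S.pp * S.β k * S.β k ≤ S.τp * S.pp * S.β k *
      ∑ j, S.β j * ‖star (S.pilot j) ⬝ᵥ S.pilot k‖ ^ 2 :=
    mul_le_mul_of_nonneg_left this (by have := h3 k; positivity)
  have h5 := mul_pos (h3 k) h2
  nlinarith

variable {S}

theorem ξ_eq_of_orthogonalPilots (hS : S.OrthogonalPilots) (k : Fin K) :
    S.ξ k = S.τp * S.pp * S.β k ^ 2 / (S.τp * S.pp * S.β k + S.σsq) := by
  rw [ξ, Finset.sum_eq_single k]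
  · simp [star_pilot_dotProduct_self]
  · intro j _ hj
    simp [hS j k hj]
  · simp

end System

variable {S}

/-- The linear MMSE estimate is a function of the training signal, and its error is uncorrelated
with that signal, hence independent of it. So the conditional expectation of the error is zero and
the linear estimate is the conditional expectation of the channel. -/
theorem IsTrainingMMSE.estimateStatistics [IsProbabilityMeasure μ] (hS : S.OrthogonalPilots)
    {H Hhat : Ω → Matrix ι (Fin K) ℂ} (h : IsTrainingMMSE S μ H Hhat) :
    EstimateStatistics S μ H Hhat := by
  classical
  obtain ⟨Hbar, N, mH, mN, hH, lH, iH, lN, iN, hHN, hcond⟩ := h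
  have hτ : (0 : ℝ) < S.τp := by exact_mod_cast S.τp_pos
  have hp := S.pp_pos
  have hσ := S.σsq_pos
  have hβ := S.β_pos
  set a : ℝ := Real.sqrt (S.τp * S.pp) with ha
  have ha2 : a ^ 2 = S.τp * S.pp := Real.sq_sqrt (by positivity)
  let b : Fin K → ℝ := fun k => Real.sqrt (S.β k)
  have hb2 : ∀ k, b k ^ 2 = S.β k := fun k => Real.sq_sqrt (hβ k).le
  let D : Fin K → ℝ := fun k => a ^ 2 * b k ^ 2 + S.σsq
  have hD : ∀ k, 0 < D k := fun k => by positivity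
  -- The MMSE weight: covariance of channel and despread signal over the variance `D k` of the
  -- latter.
  let c : Fin K → ℝ := fun k => a * b k ^ 2 / D k
  have hξ : ∀ k, S.ξ k = a ^ 2 * (b k ^ 2) ^ 2 / D k := fun k => by
    rw [System.ξ_eq_of_orthogonalPilots hS, ha2, hb2]
    simp only [D, ha2, hb2]
  let X : Fin K ⊕ Fin S.τp → Ω → ι → ℂ :=
    Sum.elim (fun k ω i => Hbar ω i k) (fun t ω i => N ω i t)
  have hX := isWhite_sum_blocks zero_le_one hσ.le lH iH lN iN
    (hHN.comp (φ := fun (x : ι → Fin K → ℂ) k i => x i k)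
      (ψ := fun (x : ι → Fin S.τp → ℂ) t i => x i t) (by fun_prop) (by fun_prop))
  let s : Fin K ⊕ Fin S.τp → ℝ := Sum.elim (fun _ => 1) (fun _ => S.σsq)
  replace hX : IsWhite (fun ω (p : (Fin K ⊕ Fin S.τp) × ι) => X p.1 ω p.2) (fun p => s p.1) μ := hX
  -- Coefficients over (fading, noise): `q k` for the estimate, `e k` for the error, `y t` for the
  -- training sample at time `t`.
  let q : Fin K → Fin K ⊕ Fin S.τp → ℂ := fun k =>
    Sum.elim (fun j => if j = k then ((c k * a * b k : ℝ) : ℂ) else 0) (fun t => c k * S.pilot k t)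
  let e : Fin K → Fin K ⊕ Fin S.τp → ℂ := fun k =>
    Sum.elim (fun j => if j = k then ((b k * (1 - c k * a) : ℝ) : ℂ) else 0)
      (fun t => -(c k * S.pilot k t))
  let y : Fin S.τp → Fin K ⊕ Fin S.τp → ℂ := fun t =>
    Sum.elim (fun j => ((a * b j : ℝ) : ℂ) * star (S.pilot j t)) (fun t' => if t' = t then 1 else 0)
  have hpp : ∀ k l, ∑ t, S.pilot k t * star (S.pilot l t) = if k = l then 1 else 0 := by
    intro k l
    have : ∑ t, S.pilot k t * star (S.pilot l t) = star (S.pilot l) ⬝ᵥ S.pilot k :=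
      Finset.sum_congr rfl fun t _ => mul_comm _ _
    rw [this]
    split_ifs with hkl
    · rw [hkl, S.star_pilot_dotProduct_self]
    · exact hS l k (Ne.symm hkl)
  have hc : ∀ k, c k * D k = a * b k ^ 2 := fun k => div_mul_cancel₀ _ (hD k).ne'
  have hξc : ∀ k, S.ξ k = a * b k ^ 2 * c k := fun k => by
    rw [hξ]; simp only [c]; ring
  have r1 : ∀ k, (c k * a * b k) ^ 2 + S.σsq * c k ^ 2 = S.ξ k := fun k => by
    rw [hξc]; linear_combination c k * hc k
  have r2 : ∀ k, (b k * (1 - c k * a)) ^ 2 + S.σsq * c k ^ 2 = S.ε k := fun k => by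
    rw [System.ε, hξc, ← hb2]; linear_combination c k * hc k
  -- The normal equation: this choice of `c k` decorrelates the error from every training sample.
  have r3 : ∀ k, b k * (1 - c k * a) * (a * b k) - S.σsq * c k = 0 := fun k => by
    linear_combination -hc k
  have hstar : ∀ x : ℝ, star (x : ℂ) = x := Complex.conj_ofReal
  have hqq : ∀ k l, ∑ x, (s x : ℂ) * (q k x * star (q l x)) = if k = l then (S.ξ k : ℂ) else 0 := by
    intro k l
    have h2 : ∑ t, (S.σsq : ℂ) * (c k * S.pilot k t * star (c l * S.pilot l t)) =
        S.σsq * c k * c l * ∑ t, S.pilot k t * star (S.pilot l t) := by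
      rw [Finset.mul_sum]
      refine Finset.sum_congr rfl fun t _ => ?_
      rw [star_mul, hstar]
      ring
    rw [Fintype.sum_sum_type]
    simp only [s, q, Sum.elim_inl, Sum.elim_inr]
    rw [h2, hpp, Finset.sum_eq_single k (fun j _ hj => by simp [hj]) (by simp), if_pos rfl]
    split_ifs with hkl
    · rw [hstar, ← r1 k, hkl]
      push_cast
      ring
    · simp
  have hee : ∀ k, ∑ x, (s x : ℂ) * (e k x * star (e k x)) = (S.ε k : ℂ) := by
    intro k
    have h2 : ∑ t, (S.σsq : ℂ) * (-(c k * S.pilot k t) * star (-(c k * S.pilot k t))) =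
        S.σsq * c k * c k * ∑ t, S.pilot k t * star (S.pilot k t) := by
      rw [Finset.mul_sum]
      refine Finset.sum_congr rfl fun t _ => ?_
      rw [star_neg, star_mul, hstar]
      ring
    rw [Fintype.sum_sum_type]
    simp only [s, e, Sum.elim_inl, Sum.elim_inr]
    rw [h2, hpp, Finset.sum_eq_single k (fun j _ hj => by simp [hj]) (by simp), if_pos rfl,
      if_pos rfl, hstar, ← r2 k]
    push_cast
    ring
  have hey : ∀ k t, ∑ x, (s x : ℂ) * (e k x * star (y t x)) = 0 := by
    intro k t
    rw [Fintype.sum_sum_type]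
    simp only [s, e, y, Sum.elim_inl, Sum.elim_inr]
    rw [Finset.sum_eq_single k (fun j _ hj => by simp [hj]) (by simp), if_pos rfl,
      Finset.sum_eq_single t (fun j _ hj => by simp [hj]) (by simp), if_pos rfl, star_mul, star_star,
      hstar, star_one]
    have := congrArg (fun x : ℝ => (x : ℂ)) (r3 k)
    push_cast at this ⊢
    linear_combination S.pilot k t * this
  have hYeq : trainingSignal S H N = fun ω i t => ∑ x, y t x * X x ω i := by
    ext ω i t
    rw [Fintype.sum_sum_type]
    simp only [trainingSignal, X, y, Sum.elim_inl, Sum.elim_inr, hH, ← ha, Finset.mul_sum]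
    congr 1
    · refine Finset.sum_congr rfl fun j _ => ?_
      simp only [b]
      push_cast
      ring
    · simp
  -- Correlating with pilot `k` removes the other users by orthogonality, so the estimate is a
  -- function of the training signal.
  have hqY : ∀ k ω i, ∑ x, q k x * X x ω i =
      c k * ∑ t, trainingSignal S H N ω i t * S.pilot k t := by
    intro k ω i
    have h1 : ∑ t, (∑ j, ((a * b j : ℝ) : ℂ) * star (S.pilot j t) * Hbar ω i j) * S.pilot k t =
        a * b k * Hbar ω i k := by
      simp_rw [Finset.sum_mul]
      rw [Finset.sum_comm]
      have : ∀ j, ∑ t, ((a * b j : ℝ) : ℂ) * star (S.pilot j t) * Hbar ω i j * S.pilot k t =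
          a * b j * Hbar ω i j * if k = j then 1 else 0 := by
        intro j
        rw [← hpp, Finset.mul_sum]
        refine Finset.sum_congr rfl fun t _ => ?_
        push_cast
        ring
      simp_rw [this]
      simp
    rw [hYeq]
    simp only [Fintype.sum_sum_type, X, q, y, Sum.elim_inl, Sum.elim_inr, add_mul,
      Finset.sum_add_distrib]
    rw [h1, mul_add, Finset.mul_sum]
    congr 1
    · simp
      ring
    · refine Finset.sum_congr rfl fun t _ => ?_
      simp
      ring
  have hHX : ∀ k ω i, H ω i k = ∑ x, q k x * X x ω i + ∑ x, e k x * X x ω i := by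
    intro k ω i
    rw [← Finset.sum_add_distrib, Fintype.sum_sum_type]
    simp only [X, q, e, Sum.elim_inl, Sum.elim_inr]
    rw [Finset.sum_eq_single k (fun j _ hj => by simp [hj]) (by simp),
      Finset.sum_eq_zero fun t _ => by ring, hH, if_pos rfl, if_pos rfl]
    simp only [b]
    push_cast
    ring
  have lq := fun k => hasLaw_sum_blocks hX (S.ξ_pos k).le ((hqq k k).trans (if_pos rfl))
  have le := fun k => hasLaw_sum_blocks hX (S.ε_nonneg k) (hee k)
  have iq := iIndepFun_sum_blocks hX (fun k => (S.ξ_pos k).le)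
    (fun k => (hqq k k).trans (if_pos rfl)) (fun k l hkl => (hqq k l).trans (if_neg hkl))
  have ieY : ∀ k, IndepFun (fun ω i => ∑ x, e k x * X x ω i) (trainingSignal S H N) μ := by
    intro k
    rw [hYeq]
    exact indepFun_sum_blocks hX (hey k)
  have mX : ∀ x i, Measurable fun ω => X x ω i := by
    rintro (k | t) i
    · exact mH i k
    · exact mN i t
  have mY : Measurable (trainingSignal S H N) := by
    rw [hYeq]
    fun_prop
  have hest : ∀ k i, (fun ω => Hhat ω i k) =ᵐ[μ] fun ω => ∑ x, q k x * X x ω i := by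
    intro k i
    refine (hcond i k).trans ?_
    have hsplit : (fun ω => H ω i k) =
        (fun ω => ∑ x, q k x * X x ω i) + fun ω => ∑ x, e k x * X x ω i :=
      funext fun ω => hHX k ω i
    have iq1 := (memLp_of_hasLaw_complexGaussianVec (lq k) i (p := 1) (by simp)).integrable le_rfl
    have ie1 := (memLp_of_hasLaw_complexGaussianVec (le k) i (p := 1) (by simp)).integrable le_rfl
    rw [hsplit]
    refine (condExp_add iq1 ie1 _).trans ?_
    have h1 : μ[fun ω => ∑ x, q k x * X x ω i | MeasurableSpace.comap (trainingSignal S H N)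
        inferInstance] = fun ω => ∑ x, q k x * X x ω i := by
      refine condExp_of_stronglyMeasurable mY.comap_le ?_ iq1
      have : Measurable[MeasurableSpace.comap (trainingSignal S H N) inferInstance]
          fun ω => ∑ x, q k x * X x ω i := by
        simp_rw [hqY]
        have hm : Measurable fun Y : ι → Fin S.τp → ℂ => c k * ∑ t, Y i t * S.pilot k t := by
          fun_prop
        exact hm.comp (comap_measurable _)
      exact this.stronglyMeasurable
    have h2 : μ[fun ω => ∑ x, e k x * X x ω i | MeasurableSpace.comap (trainingSignal S H N)
        inferInstance] =ᵐ[μ] fun _ => 0 := by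
      have mE : Measurable fun ω i => ∑ x, e k x * X x ω i := by fun_prop
      have hm : Measurable[MeasurableSpace.comap (fun ω i => ∑ x, e k x * X x ω i) inferInstance]
          fun ω => ∑ x, e k x * X x ω i :=
        (measurable_pi_apply i).comp (comap_measurable (fun ω i => ∑ x, e k x * X x ω i))
      refine (condExp_indep_eq mE.comap_le mY.comap_le hm.stronglyMeasurable
        ((IndepFun_iff_Indep _ _ _).1 (ieY k))).trans ?_
      rw [integral_eval_complexGaussianVec (le k) i]
    rw [h1]
    filter_upwards [h2] with ω hω
    rw [Pi.add_apply, hω, add_zero]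
  have hcol : ∀ k, (fun ω i => Hhat ω i k) =ᵐ[μ] fun ω i => ∑ x, q k x * X x ω i := by
    intro k
    filter_upwards [ae_all_iff.2 (hest k)] with ω hω
    exact funext hω
  have hecol : ∀ k, (fun ω i => H ω i k - Hhat ω i k) =ᵐ[μ] fun ω i => ∑ x, e k x * X x ω i := by
    intro k
    filter_upwards [ae_all_iff.2 (hest k)] with ω hω
    ext i
    rw [hω i, hHX]
    ring
  refine ⟨fun k => (lq k).congr (hcol k), fun k => (le k).congr (hecol k),
    (iIndepFun_congr hcol).2 iq, fun k => ?_⟩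
  have hfull : (fun (ω : Ω) (i : ι) (j : Fin K) => Hhat ω i j) =ᵐ[μ]
      fun ω i j => c j * ∑ t, trainingSignal S H N ω i t * S.pilot j t := by
    filter_upwards [ae_all_iff.2 fun j => ae_all_iff.2 (hest j)] with ω hω
    ext i j
    rw [hω, hqY]
  refine IndepFun.congr ?_ (hecol k).symm hfull.symm
  exact (ieY k).comp measurable_id
    (ψ := fun (Y : ι → Fin S.τp → ℂ) i j => (c j : ℂ) * ∑ t, Y i t * S.pilot j t) (by fun_prop)

end Training

/-! ### Inverse moments of Gaussian vectors -/

theorem integral_exp_neg_mul_sq_gaussianReal {v t : ℝ} (hv : 0 < v) (ht : 0 ≤ t) :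
    ∫ x, Real.exp (-t * x ^ 2) ∂gaussianReal 0 v.toNNReal = (Real.sqrt (1 + 2 * v * t))⁻¹ := by
  have hv' : v.toNNReal ≠ 0 := by simpa using hv
  rw [integral_gaussianReal_eq_integral_smul hv']
  have h1 : ∀ x : ℝ, gaussianPDFReal 0 v.toNNReal x • Real.exp (-t * x ^ 2) =
      (Real.sqrt (2 * Real.pi * v))⁻¹ * Real.exp (-(1 / (2 * v) + t) * x ^ 2) := by
    intro x
    rw [gaussianPDFReal_def, Real.coe_toNNReal _ hv.le, smul_eq_mul, mul_assoc, ← Real.exp_add]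
    congr 2
    field_simp
    ring
  simp_rw [h1]
  rw [integral_const_mul, integral_gaussian, ← Real.sqrt_inv, ← Real.sqrt_inv, ← Real.sqrt_mul
    (by positivity)]
  congr 1
  have := Real.pi_pos
  field_simp

theorem integral_exp_neg_mul_norm_sq_complexGaussian {s t : ℝ} (hs : 0 < s) (ht : 0 ≤ t) :
    ∫ z, Real.exp (-t * ‖z‖ ^ 2) ∂complexGaussian s = (1 + s * t)⁻¹ := by
  rw [integral_complexGaussian]
  have h1 : ∀ p : ℝ × ℝ, Real.exp (-t * ‖(⟨p.1, p.2⟩ : ℂ)‖ ^ 2) =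
      Real.exp (-t * p.1 ^ 2) * Real.exp (-t * p.2 ^ 2) := fun p => by
    rw [← Complex.normSq_eq_norm_sq, Complex.normSq_apply, ← Real.exp_add]
    congr 1
    ring
  simp_rw [h1]
  rw [integral_prod_mul (fun x : ℝ => Real.exp (-t * x ^ 2)) (fun x : ℝ => Real.exp (-t * x ^ 2)),
    integral_exp_neg_mul_sq_gaussianReal (by positivity) ht, ← mul_inv,
    Real.mul_self_sqrt (by positivity)]
  congr 1
  ring

theorem lintegral_exp_neg_mul_complexGaussianVec {κ : Type*} [Fintype κ] {s t : ℝ} (hs : 0 < s)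
    (ht : 0 ≤ t) :
    ∫⁻ x, ENNReal.ofReal (Real.exp (-t * ∑ i, ‖x i‖ ^ 2)) ∂complexGaussianVec κ s =
      ENNReal.ofReal ((1 + s * t)⁻¹ ^ Fintype.card κ) := by
  rw [← integral_exp_neg_mul_norm_sq_complexGaussian hs ht,
    ← integral_fintype_prod_eq_pow (ι := κ) (fun z : ℂ => Real.exp (-t * ‖z‖ ^ 2)),
    ofReal_integral_eq_lintegral_ofReal]
  · simp_rw [← Real.exp_sum, ← Finset.mul_sum]
    rfl
  · refine Integrable.fintype_prod (f := fun _ z => Real.exp (-t * ‖z‖ ^ 2)) fun _ => ?_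
    refine Integrable.of_bound (Continuous.aestronglyMeasurable (by fun_prop)) 1
      (Filter.Eventually.of_forall fun z => ?_)
    rw [Real.norm_eq_abs, Real.abs_exp, Real.exp_le_one_iff]
    nlinarith [sq_nonneg ‖z‖]
  · exact Filter.Eventually.of_forall fun x => Finset.prod_nonneg fun i _ => (Real.exp_pos _).le

/-- Stated in `ENNReal` so that it also holds at `r = 0`, where both sides are `⊤`. -/
theorem lintegral_exp_neg_mul_Ioi {r : ℝ} (hr : 0 ≤ r) :
    ∫⁻ t in Set.Ioi (0 : ℝ), ENNReal.ofReal (Real.exp (-t * r)) = (ENNReal.ofReal r)⁻¹ := by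
  rcases hr.eq_or_lt with rfl | hr
  · simp
  · have h : ∀ t : ℝ, Real.exp (-t * r) = Real.exp (-r * t) := fun t => by congr 1; ring
    simp_rw [h]
    rw [← ofReal_integral_eq_lintegral_ofReal (integrableOn_exp_mul_Ioi (by linarith) 0)
      (Filter.Eventually.of_forall fun t => (Real.exp_pos _).le), integral_exp_mul_Ioi (by linarith)]
    rw [← ENNReal.ofReal_inv_of_pos hr]
    congr 1
    simp [neg_div_neg_eq]

theorem lintegral_inv_one_add_mul_pow_Ioi {s : ℝ} (hs : 0 < s) (n : ℕ) :
    ∫⁻ t in Set.Ioi (0 : ℝ), ENNReal.ofReal ((1 + s * t)⁻¹ ^ (n + 2)) =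
      ENNReal.ofReal (1 / (s * (n + 1))) := by
  have hpos : ∀ t : ℝ, 0 ≤ t → 0 < 1 + s * t := fun t ht => by positivity
  let g : ℝ → ℝ := fun t => -((1 + s * t)⁻¹ ^ (n + 1)) / (s * (n + 1))
  have hd : ∀ t ∈ Set.Ici (0 : ℝ), HasDerivAt g ((1 + s * t)⁻¹ ^ (n + 2)) t := by
    intro t ht
    have h0 := hpos t ht
    have h1 : HasDerivAt (fun t : ℝ => 1 + s * t) s t := by
      simpa using ((hasDerivAt_id t).const_mul s).const_add 1
    refine (((h1.fun_inv h0.ne').fun_pow (n + 1)).fun_neg.div_const (s * (n + 1))).congr_deriv ?_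
    have : (n : ℝ) + 1 ≠ 0 := by positivity
    push_cast
    simp only [inv_pow]
    field_simp
    simp [pow_add, mul_comm]
  have hn : ∀ t ∈ Set.Ioi (0 : ℝ), 0 ≤ (1 + s * t)⁻¹ ^ (n + 2) := fun t ht => by
    have := hpos t (le_of_lt ht); positivity
  have hl : Filter.Tendsto g Filter.atTop (nhds 0) := by
    have h1 : Filter.Tendsto (fun t : ℝ => 1 + s * t) Filter.atTop Filter.atTop :=
      Filter.tendsto_atTop_add_const_left _ _ (Filter.tendsto_id.const_mul_atTop hs)
    have h2 := ((((tendsto_inv_atTop_zero.comp h1).pow (n + 1)).neg).div_const (s * (n + 1)))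
    simpa [g] using h2
  rw [← ofReal_integral_eq_lintegral_ofReal (integrableOn_Ioi_deriv_of_nonneg' hd hn hl)
    ((ae_restrict_iff' measurableSet_Ioi).2 (Filter.Eventually.of_forall hn)),
    integral_Ioi_of_hasDerivAt_of_nonneg' hd hn hl]
  congr 1
  simp [g, neg_div]

/-- By Tonelli, the inverse moment is the integral over `t > 0` of the Laplace transform `(1 + s
t)⁻ⁿ` of the squared norm, `n` being the dimension; this converges exactly for `n ≥ 2`. -/
theorem lintegral_inv_norm_sq_complexGaussianVec {κ : Type*} [Fintype κ] {s : ℝ} (hs : 0 < s)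
    (hκ : 2 ≤ Fintype.card κ) :
    ∫⁻ x, (ENNReal.ofReal (∑ i, ‖x i‖ ^ 2))⁻¹ ∂complexGaussianVec κ s =
      ENNReal.ofReal (1 / (s * ((Fintype.card κ : ℝ) - 1))) := by
  obtain ⟨n, hn⟩ := Nat.exists_eq_add_of_le' hκ
  have h1 : ∀ x : κ → ℂ, (ENNReal.ofReal (∑ i, ‖x i‖ ^ 2))⁻¹ =
      ∫⁻ t in Set.Ioi (0 : ℝ), ENNReal.ofReal (Real.exp (-t * ∑ i, ‖x i‖ ^ 2)) := fun x =>
    (lintegral_exp_neg_mul_Ioi (by positivity)).symm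
  simp_rw [h1]
  rw [lintegral_lintegral_swap]
  · rw [setLIntegral_congr_fun measurableSet_Ioi
      (fun t ht => lintegral_exp_neg_mul_complexGaussianVec hs (le_of_lt ht)), hn,
      lintegral_inv_one_add_mul_pow_Ioi hs]
    congr 3
    push_cast
    ring
  · exact Measurable.aemeasurable (by unfold Function.uncurry; fun_prop)

section Projection

variable {ι κ : Type*} [Fintype ι] [Fintype κ]

/-- Unitary invariance: orthonormal coefficient vectors give orthogonal forms of equal variance in a
white vector. -/
theorem hasLaw_inner_orthonormal {s : ℝ} (hs : 0 ≤ s) {u : κ → EuclideanSpace ℂ ι}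
    (hu : Orthonormal ℂ u) :
    HasLaw (fun (x : ι → ℂ) j => inner ℂ (u j) (WithLp.toLp 2 x)) (complexGaussianVec κ s)
      (complexGaussianVec ι s) := by
  classical
  have hX : IsWhite (fun x : ι → ℂ => x) (fun _ => s) (complexGaussianVec ι s) :=
    isWhite_of_hasLaw hs HasLaw.id
  refine (IsWhite.form hX (A := fun j i => star (u j i)) (r := fun _ => s) fun m n => ?_).hasLaw hs
    |>.congr (Filter.Eventually.of_forall fun x => ?_)
  · have h := orthonormal_iff_ite.1 hu m n
    rw [PiLp.inner_apply] at h
    rw [← Finset.mul_sum]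
    have h2 : ∑ i, star (u m i) * star (star (u n i)) = if m = n then 1 else 0 := by
      rw [← h]
      refine Finset.sum_congr rfl fun i _ => ?_
      rw [star_star, mul_comm]
      rfl
    rw [h2]
    simp
  · ext j
    refine (PiLp.inner_apply _ _).trans ?_
    refine Finset.sum_congr rfl fun i _ => ?_
    exact mul_comm _ _

theorem lintegral_inv_norm_sq_starProjection {s : ℝ} (hs : 0 < s)
    (U : Submodule ℂ (EuclideanSpace ℂ ι)) (hU : 2 ≤ Module.finrank ℂ U) :
    ∫⁻ x, (ENNReal.ofReal (‖U.starProjection (WithLp.toLp 2 x)‖ ^ 2))⁻¹ ∂complexGaussianVec ι s =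
      ENNReal.ofReal (1 / (s * ((Module.finrank ℂ U : ℝ) - 1))) := by
  let u := stdOrthonormalBasis ℂ U
  have hu : Orthonormal ℂ (fun j => (u j : EuclideanSpace ℂ ι)) :=
    u.orthonormal.comp_linearIsometry U.subtypeₗᵢ
  have h := (hasLaw_inner_orthonormal hs.le hu).lintegral_comp
    (f := fun x => (ENNReal.ofReal (∑ i, ‖x i‖ ^ 2))⁻¹) (Measurable.aemeasurable (by fun_prop))
  rw [lintegral_inv_norm_sq_complexGaussianVec hs (by simpa using hU), Fintype.card_fin] at h
  rw [← h]
  refine lintegral_congr fun x => ?_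
  congr 2
  rw [Submodule.starProjection_apply, ← Submodule.coe_norm, ← u.sum_sq_norm_inner_right]
  refine Finset.sum_congr rfl fun j _ => ?_
  simp only [Submodule.inner_orthogonalProjectionOnto_eq_of_mem_left]

/-- Distance from `x` to the span of the vectors `h j`. -/
noncomputable def spanDist (h : κ → ι → ℂ) (x : ι → ℂ) : ℝ :=
  ⨅ c : κ → ℂ, ‖WithLp.toLp 2 (x - ∑ j, c j • h j)‖

/-- An infimum of continuous functions, even an uncountable one, is upper semicontinuous, hence
Borel. Joint measurability would be harder to see from the projection, whose rank may jump. -/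
theorem measurable_spanDist :
    Measurable fun p : (κ → ι → ℂ) × (ι → ℂ) => spanDist p.1 p.2 := by
  refine UpperSemicontinuous.measurable (upperSemicontinuous_ciInf (fun p => ?_) fun c => ?_)
  · exact ⟨0, by rintro _ ⟨c, rfl⟩; exact norm_nonneg _⟩
  · exact Continuous.upperSemicontinuous (by fun_prop)

/-- The span of the vectors `h j` in the Euclidean space. -/
noncomputable def euclideanSpan (h : κ → ι → ℂ) : Submodule ℂ (EuclideanSpace ℂ ι) :=
  Submodule.span ℂ (Set.range fun j => (WithLp.toLp 2 (h j) : EuclideanSpace ℂ ι))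

theorem spanDist_eq_norm_starProjection (h : κ → ι → ℂ) (x : ι → ℂ) :
    spanDist h x = ‖(euclideanSpan h)ᗮ.starProjection (WithLp.toLp 2 x)‖ := by
  rw [Submodule.starProjection_orthogonal_val, Submodule.starProjection_minimal, spanDist]
  have hmem : ∀ c : κ → ℂ, ∑ j, c j • (WithLp.toLp 2 (h j) : EuclideanSpace ℂ ι) ∈
      euclideanSpan h := fun c =>
    Submodule.sum_mem _ fun j _ => Submodule.smul_mem _ _ (Submodule.subset_span ⟨j, rfl⟩)
  have hs : Function.Surjective fun c : κ → ℂ => (⟨_, hmem c⟩ : euclideanSpan h) := by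
    rintro ⟨y, hy⟩
    obtain ⟨c, hc⟩ := (Submodule.mem_span_range_iff_exists_fun ℂ).1 hy
    exact ⟨c, Subtype.ext hc⟩
  rw [← hs.iInf_comp]
  refine iInf_congr fun c => ?_
  rw [WithLp.toLp_sub, WithLp.toLp_sum]
  rfl

/-- This bound needs no linear independence, so finiteness of the inverse moment can be used to
prove independence. -/
theorem finrank_orthogonal_euclideanSpan (h : κ → ι → ℂ) :
    Fintype.card ι ≤ Module.finrank ℂ (euclideanSpan h)ᗮ + Fintype.card κ := by
  have h1 := Submodule.finrank_add_finrank_orthogonal (euclideanSpan h)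
  rw [finrank_euclideanSpace] at h1
  have h2 : Module.finrank ℂ (euclideanSpan h) ≤ Fintype.card κ := finrank_range_le_card _
  omega

theorem linearIndependent_toLp_iff {h : κ → ι → ℂ} :
    LinearIndependent ℂ (fun j => (WithLp.toLp 2 (h j) : EuclideanSpace ℂ ι)) ↔
      LinearIndependent ℂ h :=
  LinearMap.linearIndependent_iff_of_injOn
    ((WithLp.linearEquiv 2 ℂ (ι → ℂ)).symm : (ι → ℂ) →ₗ[ℂ] EuclideanSpace ℂ ι)
    (LinearEquiv.injective _).injOn

theorem finrank_orthogonal_euclideanSpan_of_linearIndependent {h : κ → ι → ℂ}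
    (hh : LinearIndependent ℂ h) :
    Fintype.card ι = Module.finrank ℂ (euclideanSpan h)ᗮ + Fintype.card κ := by
  have h1 := Submodule.finrank_add_finrank_orthogonal (euclideanSpan h)
  rw [finrank_euclideanSpace] at h1
  have h2 : Module.finrank ℂ (euclideanSpan h) = Fintype.card κ :=
    finrank_span_eq_card (linearIndependent_toLp_iff.2 hh)
  omega

end Projection

/-! ### The zero-forcing precoder -/

section ZeroForcing

variable {Ω ι κ : Type*} [MeasurableSpace Ω] {μ : Measure Ω} [Fintype ι] [Fintype κ]

/-- Fubini over the law of `X`: for fixed `h`, the distance is the norm of a Gaussian vector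
projected onto `(euclideanSpan h)ᗮ`. The dimension may still depend on `h`. -/
theorem lintegral_inv_sq_spanDist [IsProbabilityMeasure μ] {s : ℝ} (hs : 0 < s)
    {X : Ω → κ → ι → ℂ} {g : Ω → ι → ℂ} (hX : AEMeasurable X μ)
    (hg : HasLaw g (complexGaussianVec ι s) μ) (hind : IndepFun X g μ)
    (hcard : Fintype.card κ + 2 ≤ Fintype.card ι) :
    ∫⁻ ω, (ENNReal.ofReal (spanDist (X ω) (g ω) ^ 2))⁻¹ ∂μ =
      ∫⁻ h, ENNReal.ofReal (1 / (s * ((Module.finrank ℂ (euclideanSpan h)ᗮ : ℝ) - 1)))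
        ∂(μ.map X) := by
  have hm : Measurable fun p : (κ → ι → ℂ) × (ι → ℂ) =>
      (ENNReal.ofReal (spanDist p.1 p.2 ^ 2))⁻¹ :=
    (measurable_spanDist.pow_const 2).ennreal_ofReal.inv
  have hlaw := (indepFun_iff_map_prod_eq_prod_map_map hX hg.aemeasurable).1 hind
  have := Measure.isProbabilityMeasure_map hX
  rw [← lintegral_map' (f := fun p : (κ → ι → ℂ) × (ι → ℂ) =>
      (ENNReal.ofReal (spanDist p.1 p.2 ^ 2))⁻¹) hm.aemeasurable (hX.prodMk hg.aemeasurable),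
    hlaw, hg.map_eq, lintegral_prod _ hm.aemeasurable]
  refine lintegral_congr fun h => ?_
  simp only [spanDist_eq_norm_starProjection]
  have := finrank_orthogonal_euclideanSpan h
  exact lintegral_inv_norm_sq_starProjection hs _ (by omega)

theorem ae_spanDist_ne_zero [IsProbabilityMeasure μ] {s : ℝ} (hs : 0 < s)
    {X : Ω → κ → ι → ℂ} {g : Ω → ι → ℂ} (hX : AEMeasurable X μ)
    (hg : HasLaw g (complexGaussianVec ι s) μ) (hind : IndepFun X g μ)
    (hcard : Fintype.card κ + 2 ≤ Fintype.card ι) :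
    ∀ᵐ ω ∂μ, spanDist (X ω) (g ω) ≠ 0 := by
  have := Measure.isProbabilityMeasure_map hX
  have hle : ∀ h : κ → ι → ℂ,
      ENNReal.ofReal (1 / (s * ((Module.finrank ℂ (euclideanSpan h)ᗮ : ℝ) - 1))) ≤
        ENNReal.ofReal (1 / s) := by
    intro h
    refine ENNReal.ofReal_le_ofReal (one_div_le_one_div_of_le hs ?_)
    have h1 := finrank_orthogonal_euclideanSpan h
    generalize Module.finrank ℂ (euclideanSpan h)ᗮ = d at h1
    have h2 : (2 : ℝ) ≤ d := by exact_mod_cast (by omega : 2 ≤ d)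
    exact le_mul_of_one_le_right hs.le (by linarith)
  have hfin : ∫⁻ ω, (ENNReal.ofReal (spanDist (X ω) (g ω) ^ 2))⁻¹ ∂μ ≠ ⊤ := by
    rw [lintegral_inv_sq_spanDist hs hX hg hind hcard]
    refine ne_top_of_le_ne_top (b := ENNReal.ofReal (1 / s)) ENNReal.ofReal_ne_top ?_
    refine (lintegral_mono hle).trans ?_
    simp
  have hm : Measurable fun p : (κ → ι → ℂ) × (ι → ℂ) =>
      (ENNReal.ofReal (spanDist p.1 p.2 ^ 2))⁻¹ :=
    (measurable_spanDist.pow_const 2).ennreal_ofReal.inv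
  filter_upwards [ae_lt_top' (hm.comp_aemeasurable (hX.prodMk hg.aemeasurable)) hfin] with ω hω h0
  -- At distance zero the integrand is `0⁻¹ = ⊤`, which a finite integral allows only on a null set.
  simp [h0] at hω

variable [DecidableEq κ] {X : κ → Ω → ι → ℂ} {r : κ → ℝ}

/-- The family `x` with the member `k` removed. -/
def removeIndex {α : Type*} (x : κ → α) (k : κ) : ↥(Finset.univ.erase k) → α :=
  fun j => x j

theorem indepFun_removeIndex (hX : ∀ k, AEMeasurable (X k) μ) (hind : iIndepFun X μ) (k : κ) :
    IndepFun (fun ω => removeIndex (fun j => X j ω) k) (X k) μ :=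
  (hind.indepFun_finset₀ (Finset.univ.erase k) {k} (by simp) hX).comp measurable_id
    (ψ := fun y : ↥({k} : Finset κ) → ι → ℂ => y ⟨k, Finset.mem_singleton_self k⟩) (measurable_pi_apply _)

theorem aemeasurable_removeIndex (hX : ∀ k, AEMeasurable (X k) μ) (k : κ) :
    AEMeasurable (fun ω => removeIndex (fun j => X j ω) k) μ :=
  aemeasurable_pi_lambda _ fun j => hX j

theorem card_removeIndex_add_one (k : κ) :
    Fintype.card ↥(Finset.univ.erase k) + 1 = Fintype.card κ := by
  rw [Fintype.card_coe, Finset.card_erase_add_one (Finset.mem_univ k), Finset.card_univ]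

theorem linearIndependent_of_spanDist_ne_zero {x : κ → ι → ℂ}
    (h : ∀ k, spanDist (removeIndex x k) (x k) ≠ 0) : LinearIndependent ℂ x := by
  rw [← linearIndependent_toLp_iff, linearIndependent_iff_notMem_span]
  intro k hk
  refine h k ?_
  rw [spanDist_eq_norm_starProjection, norm_eq_zero, Submodule.starProjection_apply_eq_zero_iff,
    Submodule.orthogonal_orthogonal, euclideanSpan]
  convert! hk using 2
  ext y
  constructor
  · rintro ⟨⟨j, hj⟩, rfl⟩
    exact ⟨j, by simpa using hj, rfl⟩
  · rintro ⟨j, hj, rfl⟩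
    exact ⟨⟨j, by simpa using hj⟩, rfl⟩

theorem ae_linearIndependent [IsProbabilityMeasure μ] (hr : ∀ k, 0 < r k)
    (hX : ∀ k, HasLaw (X k) (complexGaussianVec ι (r k)) μ) (hind : iIndepFun X μ)
    (hcard : Fintype.card κ < Fintype.card ι) :
    ∀ᵐ ω ∂μ, LinearIndependent ℂ fun k => X k ω := by
  have h : ∀ᵐ ω ∂μ, ∀ k, spanDist (removeIndex (fun j => X j ω) k) (X k ω) ≠ 0 :=
    ae_all_iff.2 fun k => ae_spanDist_ne_zero (hr k)
      (aemeasurable_removeIndex (fun k => (hX k).aemeasurable) k) (hX k)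
      (indepFun_removeIndex (fun k => (hX k).aemeasurable) hind k)
      (by have := card_removeIndex_add_one k; omega)
  filter_upwards [h] with ω hω
  exact linearIndependent_of_spanDist_ne_zero hω

theorem lintegral_inv_sq_spanDist_removeIndex [IsProbabilityMeasure μ] (hr : ∀ k, 0 < r k)
    (hX : ∀ k, HasLaw (X k) (complexGaussianVec ι (r k)) μ) (hind : iIndepFun X μ)
    (hcard : Fintype.card κ < Fintype.card ι) (k : κ) :
    ∫⁻ ω, (ENNReal.ofReal (spanDist (removeIndex (fun j => X j ω) k) (X k ω) ^ 2))⁻¹ ∂μ =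
      ENNReal.ofReal (1 / (r k * ((Fintype.card ι : ℝ) - Fintype.card κ))) := by
  have hm := aemeasurable_removeIndex (fun k => (hX k).aemeasurable) k
  have hk := card_removeIndex_add_one k
  have := Measure.isProbabilityMeasure_map hm
  rw [lintegral_inv_sq_spanDist (hr k) hm (hX k)
    (indepFun_removeIndex (fun k => (hX k).aemeasurable) hind k) (by omega)]
  -- Almost sure independence fixes the dimension of the complement at `card ι - (card κ - 1)`;
  -- subtracting one yields `card ι - card κ`.
  have hLI : ∀ᵐ h ∂(μ.map fun ω => removeIndex (fun j => X j ω) k), LinearIndependent ℂ h := by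
    rw [ae_map_iff hm isOpen_setOfPred_linearIndependent.measurableSet]
    filter_upwards [ae_linearIndependent hr hX hind hcard] with ω hω
    exact hω.comp (fun j : (Finset.univ.erase k : Finset κ) => (j : κ)) Subtype.val_injective
  rw [lintegral_congr_ae (g := fun _ =>
    ENNReal.ofReal (1 / (r k * ((Fintype.card ι : ℝ) - Fintype.card κ))))]
  · simp
  · filter_upwards [hLI] with h hh
    have h1 := finrank_orthogonal_euclideanSpan_of_linearIndependent hh
    rw [h1, ← hk]
    congr 3
    push_cast
    ring

/-! ### Algebra and measurability of the zero-forcing matrix -/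

open scoped ComplexOrder in
theorem isUnit_det_conjTranspose_mul_self {A : Matrix ι κ ℂ}
    (hA : LinearIndependent ℂ fun k i => A i k) : IsUnit (Aᴴ * A).det := by
  have h : Function.Injective A.mulVec := Matrix.mulVec_injective_iff.2 hA
  exact (Matrix.isUnit_iff_isUnit_det _).1 (Matrix.PosDef.conjTranspose_mul_self A h).isUnit

theorem conjTranspose_mul_zeroForcing {A : Matrix ι κ ℂ}
    (hA : LinearIndependent ℂ fun k i => A i k) : Aᴴ * (A * (Aᴴ * A)⁻¹) = 1 := by
  rw [← Matrix.mul_assoc, Matrix.mul_nonsing_inv _ (isUnit_det_conjTranspose_mul_self hA)]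

/-- The column `w` is orthogonal to every `a j` with `j ≠ k` and lies in the span of all of them, so
`w = c k • q` with `q` the part of `a k` orthogonal to the others. Then `⟪a k, w⟫ = 1` forces `‖c k‖
‖q‖² = 1`, that is, `‖w‖² = ‖q‖⁻²`. -/
theorem sum_norm_sq_zeroForcing {A : Matrix ι κ ℂ} (hA : LinearIndependent ℂ fun k i => A i k)
    (k : κ) :
    ∑ i, ‖(A * (Aᴴ * A)⁻¹) i k‖ ^ 2 =
      (spanDist (removeIndex (fun j i => A i j) k) (fun i => A i k) ^ 2)⁻¹ := by
  set W := A * (Aᴴ * A)⁻¹ with hW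
  let a : κ → EuclideanSpace ℂ ι := fun j => WithLp.toLp 2 fun i => A i j
  let w : EuclideanSpace ℂ ι := WithLp.toLp 2 fun i => W i k
  let c : κ → ℂ := fun j => (Aᴴ * A)⁻¹ j k
  let U := (euclideanSpan (removeIndex (fun j i => A i j) k))ᗮ
  have hinner : ∀ j, inner ℂ (a j) w = if j = k then 1 else 0 := by
    intro j
    have h := congrFun (congrFun (conjTranspose_mul_zeroForcing hA) j) k
    rw [Matrix.one_apply] at h
    rw [← h, PiLp.inner_apply]
    exact Finset.sum_congr rfl fun i _ => mul_comm _ _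
  have hw : w = ∑ j, c j • a j := by
    ext i
    simp only [w, a, c, hW, WithLp.ofLp_sum, WithLp.ofLp_smul, Finset.sum_apply, Pi.smul_apply,
      Matrix.mul_apply, smul_eq_mul]
    exact Finset.sum_congr rfl fun j _ => mul_comm _ _
  have haU : ∀ j, j ≠ k → a j ∈ euclideanSpan (removeIndex (fun j i => A i j) k) := fun j hj =>
    Submodule.subset_span ⟨⟨j, by simpa using hj⟩, rfl⟩
  have hwU : w ∈ U := by
    refine (Submodule.mem_orthogonal _ _).2 fun u hu => ?_
    refine Submodule.span_induction (p := fun u _ => inner ℂ u w = 0) ?_ (by simp) ?_ ?_ hu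
    · rintro _ ⟨⟨j, hj⟩, rfl⟩
      have := hinner j
      rw [if_neg (by simpa using hj)] at this
      exact this
    · intro x y _ _ hx hy
      rw [inner_add_left, hx, hy, add_zero]
    · intro b x _ hx
      rw [inner_smul_left, hx, mul_zero]
  let q := U.starProjection (a k)
  have hwq : w = c k • q := by
    rw [← Submodule.starProjection_eq_self_iff.2 hwU, hw, map_sum, Finset.sum_eq_single k]
    · rw [map_smul]
    · intro j _ hj
      rw [map_smul, Submodule.starProjection_orthogonal_apply_eq_zero (haU j hj), smul_zero]
    · simp
  have h1 : inner ℂ q w = 1 := by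
    have h := hinner k
    rw [if_pos rfl] at h
    rw [← h, Submodule.inner_starProjection_left_eq_right,
      Submodule.starProjection_eq_self_iff.2 hwU]
  have hsum : ∑ i, ‖W i k‖ ^ 2 = ‖w‖ ^ 2 := (EuclideanSpace.norm_sq_eq w).symm
  rw [hsum, spanDist_eq_norm_starProjection]
  change ‖w‖ ^ 2 = (‖q‖ ^ 2)⁻¹
  rw [hwq, inner_smul_right, inner_self_eq_norm_sq_to_K] at h1
  have h2 := congrArg norm h1
  rw [norm_mul, norm_pow, norm_one] at h2
  have h3 : ‖c k‖ * ‖q‖ ^ 2 = 1 := by simpa using h2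
  rw [hwq, norm_smul, mul_pow]
  refine eq_inv_of_mul_eq_one_left ?_
  linear_combination (‖c k‖ * ‖q‖ ^ 2 + 1) * h3

/-- The inverse is the reciprocal determinant times the adjugate; the reciprocal on `ℂ` is
measurable everywhere, so singular Gram matrices cause no trouble. -/
theorem measurable_zeroForcing (i : ι) (k : κ) :
    Measurable fun M : ι → κ → ℂ =>
      ((Matrix.of M * ((Matrix.of M)ᴴ * Matrix.of M)⁻¹ : Matrix ι κ ℂ)) i k := by
  simp only [Matrix.inv_def, Matrix.mul_apply, Matrix.smul_apply, smul_eq_mul, Ring.inverse_eq_inv']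
  have hof : Continuous fun M : ι → κ → ℂ => (Matrix.of M : Matrix ι κ ℂ) := continuous_id
  have hG : Continuous fun M : ι → κ → ℂ => (Matrix.of M)ᴴ * Matrix.of M :=
    hof.matrix_conjTranspose.matrix_mul hof
  refine Finset.measurable_sum _ fun j _ => ?_
  refine Measurable.mul (Continuous.measurable ?_) (Measurable.mul ?_ (Continuous.measurable ?_))
  · exact hof.matrix_elem i j
  · exact hG.matrix_det.measurable.inv
  · exact hG.matrix_adjugate.matrix_elem j k

end ZeroForcing

/-! ### Parity -/

/-- Symmetry makes the integral equal to its own negative. Integrability is not needed, as a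
non-integrable function has integral zero. -/
theorem integral_eq_zero_of_odd {Ω E : Type*} [MeasurableSpace Ω] {μ : Measure Ω}
    [MeasurableSpace E] [AddGroup E] [MeasurableNeg E] {ν : Measure E} {M : Ω → E}
    (hM : HasLaw M ν μ) (hν : ν.map (fun x => -x) = ν) {φ : E → ℂ} (hφ : Measurable φ)
    (hodd : ∀ x, φ (-x) = -φ x) : ∫ ω, φ (M ω) ∂μ = 0 := by
  have h := hM.integral_comp (f := φ) hφ.aestronglyMeasurable
  refine h.trans ?_
  have h2 : ∫ x, φ x ∂ν = -∫ x, φ x ∂ν := by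
    conv_lhs => rw [← hν, integral_map measurable_neg.aemeasurable hφ.aestronglyMeasurable]
    simp_rw [hodd, integral_neg]
  exact self_eq_neg.1 h2

theorem complexGaussianVec_map_neg {ι : Type*} [Fintype ι] (s : ℝ) :
    (complexGaussianVec ι s).map (fun x => -x) = complexGaussianVec ι s := by
  have h := Measure.pi_map_pi (μ := fun _ : ι => complexGaussian s) (f := fun _ z => -z)
    (fun _ => measurable_neg.aemeasurable)
  simp_rw [complexGaussian_map_neg] at h
  exact h

theorem pi_complexGaussianVec_map_neg {κ ι : Type*} [Fintype κ] [Fintype ι] (s : κ → ℝ) :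
    (Measure.pi fun k => complexGaussianVec ι (s k)).map (fun x => -x) =
      Measure.pi fun k => complexGaussianVec ι (s k) := by
  have h := Measure.pi_map_pi (μ := fun k : κ => complexGaussianVec ι (s k)) (f := fun _ z => -z)
    (fun _ => measurable_neg.aemeasurable)
  simp_rw [complexGaussianVec_map_neg] at h
  exact h

/-- The Gram matrix is unchanged by a sign change, so zero forcing is odd as well. -/
theorem Precoder.W_neg {ι : Type*} [Fintype ι] {K : ℕ} (bf : Precoder)
    (A : Matrix ι (Fin K) ℂ) : bf.W (-A) = -bf.W A := by
  cases bf <;> simp [Precoder.W]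

theorem Precoder.measurable_W {ι : Type*} [Fintype ι] {K : ℕ} (bf : Precoder) (i : ι)
    (j : Fin K) : Measurable fun x : Fin K → ι → ℂ => bf.W (Matrix.of fun i j => x j i) i j := by
  have h : Measurable fun (x : Fin K → ι → ℂ) (i : ι) (j : Fin K) => x j i := by fun_prop
  cases bf
  · exact (measurable_pi_apply i).comp (measurable_pi_apply j)
  · exact (measurable_zeroForcing i j).comp h

/-! ### Moments of the effective gains -/

section Gain

variable {Ω ι : Type*} [MeasurableSpace Ω] {μ : Measure Ω} [Fintype ι] {K : ℕ} {S : System K}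
  {H Hhat F : Ω → Matrix ι (Fin K) ℂ}

namespace EstimateStatistics

theorem aemeasurable_estimate (h : EstimateStatistics S μ H Hhat) :
    AEMeasurable (fun ω (j : Fin K) (i : ι) => Hhat ω i j) μ :=
  aemeasurable_pi_lambda _ fun k => (h.law_estimate k).aemeasurable

theorem memLp_estimate (h : EstimateStatistics S μ H Hhat) (i : ι) (j : Fin K) {p : ENNReal}
    (hp : p ≠ ⊤) : MemLp (fun ω => Hhat ω i j) p μ :=
  memLp_of_hasLaw_complexGaussianVec (h.law_estimate j) i hp

theorem integral_odd (h : EstimateStatistics S μ H Hhat) {φ : (Fin K → ι → ℂ) → ℂ}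
    (hφ : Measurable φ) (hodd : ∀ x, φ (-x) = -φ x) :
    ∫ ω, φ (fun j i => Hhat ω i j) ∂μ = 0 :=
  integral_eq_zero_of_odd (h.indep_estimate.hasLaw_pi h.law_estimate)
    (pi_complexGaussianVec_map_neg _) hφ hodd

theorem moments_inner_const [IsProbabilityMeasure μ] (h : EstimateStatistics S μ H Hhat)
    (k : Fin K) (v : ι → ℂ) :
    MemLp (fun ω => ∑ i, star (Hhat ω i k) * v i) 2 μ ∧
    ∫ ω, ‖∑ i, star (Hhat ω i k) * v i‖ ^ 2 ∂μ = S.ξ k * ∑ i, ‖v i‖ ^ 2 := by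
  have := moments_add_inner_gaussian (S.ξ_pos k).le (h.law_estimate k) (f := fun _ => v)
    (a := fun _ => 0) (indepFun_const_right _ _) (fun i => memLp_const _) (memLp_const _)
  simpa using And.intro this.1 this.2.2

theorem moments_inner_estimate [IsProbabilityMeasure μ] (h : EstimateStatistics S μ H Hhat)
    {k j : Fin K} (hkj : k ≠ j) :
    MemLp (fun ω => ∑ i, star (Hhat ω i k) * Hhat ω i j) 2 μ ∧
    ∫ ω, ‖∑ i, star (Hhat ω i k) * Hhat ω i j‖ ^ 2 ∂μ =
      S.ξ k * (Fintype.card ι * S.ξ j) := by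
  have hind := (h.indep_estimate.indepFun hkj).comp measurable_id
    (ψ := fun x : ι → ℂ => (x, (0 : ℂ))) (by fun_prop)
  have := moments_add_inner_gaussian (S.ξ_pos k).le (h.law_estimate k)
    (f := fun ω i => Hhat ω i j) (a := fun _ => 0) hind
    (fun i => h.memLp_estimate i j (by simp)) (memLp_const _)
  simp only [integral_norm_sq_eval_complexGaussianVec (S.ξ_pos j).le (h.law_estimate j)] at this
  simpa using And.intro this.1 this.2.2

/-- The centred variables `|ĥ_ik|² - ξ_k` are independent across antennas with variance `2 ξ_k² -
ξ_k² = ξ_k²`, hence orthogonal; the mean `N_t ξ_k` is added back at the end. -/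
theorem moments_inner_self [IsProbabilityMeasure μ] (h : EstimateStatistics S μ H Hhat)
    (k : Fin K) :
    MemLp (fun ω => ∑ i, star (Hhat ω i k) * Hhat ω i k) 2 μ ∧
    ∫ ω, ∑ i, star (Hhat ω i k) * Hhat ω i k ∂μ = ((Fintype.card ι * S.ξ k : ℝ) : ℂ) ∧
    ∫ ω, ‖∑ i, star (Hhat ω i k) * Hhat ω i k‖ ^ 2 ∂μ =
      Fintype.card ι * S.ξ k ^ 2 + (Fintype.card ι * S.ξ k) ^ 2 := by
  have hξ := (S.ξ_pos k).le
  have hlaw := h.law_estimate k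
  let Z : ι → Ω → ℂ := fun i ω => ((‖Hhat ω i k‖ ^ 2 - S.ξ k : ℝ) : ℂ)
  have hL2 : ∀ i, MemLp (fun ω => ‖Hhat ω i k‖ ^ 2) 2 μ := by
    intro i
    have h4 := h.memLp_estimate i k (p := 4) (by simp)
    rw [memLp_two_iff_integrable_sq (by exact h4.1.norm.pow 2)]
    refine (h4.integrable_norm_pow (p := 4) (by simp)).congr
      (Filter.Eventually.of_forall fun ω => ?_)
    simp only
    ring
  have hL1 : ∀ i, Integrable (fun ω => ‖Hhat ω i k‖ ^ 2) μ := fun i =>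
    (hL2 i).integrable (by norm_num)
  have hZ : ∀ i, MemLp (Z i) 2 μ := fun i => ((hL2 i).sub (memLp_const (S.ξ k))).ofReal
  have hZ0 : ∀ i, ∫ ω, Z i ω ∂μ = 0 := by
    intro i
    rw [integral_complex_ofReal, integral_sub (hL1 i) (integrable_const _),
      integral_norm_sq_eval_complexGaussianVec hξ hlaw]
    simp
  have hZ2 : ∀ i, ∫ ω, ‖Z i ω‖ ^ 2 ∂μ = S.ξ k ^ 2 := by
    intro i
    have e : ∀ ω, ‖Z i ω‖ ^ 2 =
        ‖Hhat ω i k‖ ^ 4 - 2 * S.ξ k * ‖Hhat ω i k‖ ^ 2 + S.ξ k ^ 2 := fun ω => by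
      rw [Complex.norm_real, Real.norm_eq_abs, sq_abs]
      ring
    simp_rw [e]
    have h4 := (h.memLp_estimate i k (p := 4) (by simp)).integrable_norm_pow (p := 4) (by simp)
    rw [integral_add (by exact h4.sub ((hL1 i).const_mul _)) (integrable_const _),
      integral_sub h4 ((hL1 i).const_mul _), integral_const_mul,
      integral_norm_sq_eval_complexGaussianVec hξ hlaw,
      integral_norm_pow_four_eval_complexGaussianVec hξ hlaw]
    simp
    ring
  have horth : ∀ i l, i ≠ l → ∫ ω, Z i ω * star (Z l ω) ∂μ = 0 := by
    intro i l hil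
    have hi := ((iIndepFun_eval_complexGaussianVec hlaw).indepFun hil).comp
      (φ := fun z => ((‖z‖ ^ 2 - S.ξ k : ℝ) : ℂ)) (ψ := fun z => star ((‖z‖ ^ 2 - S.ξ k : ℝ) : ℂ))
      (by fun_prop) (Continuous.measurable (by fun_prop))
    refine (hi.integral_fun_mul_eq_mul_integral (hZ i).1 (hZ l).star.1).trans ?_
    have := hZ0 i
    simp only [Z] at this
    simp only [Function.comp]
    rw [this, zero_mul]
  have hsumZ := memLp_finsetSum Finset.univ fun i (_ : i ∈ Finset.univ) => hZ i
  have hsumZ0 : ∫ ω, ∑ i, Z i ω ∂μ = 0 := by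
    rw [integral_finsetSum _ fun i _ => (hZ i).integrable (by norm_num)]
    exact Finset.sum_eq_zero fun i _ => hZ0 i
  have hdec : ∀ ω, ∑ i, star (Hhat ω i k) * Hhat ω i k =
      ∑ i, Z i ω + ((Fintype.card ι * S.ξ k : ℝ) : ℂ) := by
    intro ω
    have e : ∀ i, star (Hhat ω i k) * Hhat ω i k = Z i ω + S.ξ k := fun i => by
      have : star (Hhat ω i k) * Hhat ω i k = (‖Hhat ω i k‖ : ℂ) ^ 2 := Complex.conj_mul' _
      rw [this]
      simp [Z]
    simp_rw [e, Finset.sum_add_distrib]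
    simp
  simp_rw [hdec]
  refine ⟨hsumZ.add (memLp_const _), ?_, ?_⟩
  · rw [integral_add (hsumZ.integrable (by norm_num)) (integrable_const _), hsumZ0]
    simp
  · rw [integral_norm_sq_add_of_orthogonal hsumZ (memLp_const _) (by
      rw [integral_mul_const, hsumZ0, zero_mul]), integral_norm_sq_sum_of_orthogonal hZ horth]
    simp_rw [hZ2]
    simp [abs_of_nonneg hξ]

/-- Moments of the gain `h_kᴴ f_j` in terms of those of the precoder. -/
theorem moments_gain [IsProbabilityMeasure μ] (h : EstimateStatistics S μ H Hhat) (bf : Precoder)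
    (v : ι → ℂ) (hv : ∑ i, ‖v i‖ ^ 2 = Fintype.card ι) {γ η : Fin K → ℝ} (hγ : ∀ k, 0 ≤ γ k)
    (hη : ∀ k, 0 ≤ η k) (hF : ∀ ω, F ω = bf.F (Hhat ω) v γ η) (k j : Fin K)
    (hW : ∀ i, MemLp (fun ω => bf.W (Hhat ω) i j) 2 μ)
    (hA : MemLp (fun ω => ∑ i, star (Hhat ω i k) * bf.W (Hhat ω) i j) 2 μ) :
    MemLp (gain H F k j) 2 μ ∧
    ∫ ω, gain H F k j ω ∂μ = (Real.sqrt (γ j) : ℂ) *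
      ∫ ω, ∑ i, star (Hhat ω i k) * bf.W (Hhat ω) i j ∂μ ∧
    ∫ ω, ‖gain H F k j ω‖ ^ 2 ∂μ =
      γ j * (∫ ω, ‖∑ i, star (Hhat ω i k) * bf.W (Hhat ω) i j‖ ^ 2 ∂μ +
        S.ε k * ∑ i, ∫ ω, ‖bf.W (Hhat ω) i j‖ ^ 2 ∂μ) + η j * (Fintype.card ι * S.β k) := by
  let g : ℂ := (Real.sqrt (γ j) : ℂ)
  let n : ℂ := (Real.sqrt (η j) : ℂ)
  have hg : ‖g‖ ^ 2 = γ j := by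
    rw [Complex.norm_real, Real.norm_eq_abs, sq_abs, Real.sq_sqrt (hγ j)]
  have hn : ‖n‖ ^ 2 = η j := by
    rw [Complex.norm_real, Real.norm_eq_abs, sq_abs, Real.sq_sqrt (hη j)]
  let Wx : (Fin K → ι → ℂ) → ι → ℂ := fun x i => bf.W (Matrix.of fun i j => x j i) i j
  have hWm : ∀ i, Measurable fun x => Wx x i := fun i => bf.measurable_W i j
  have hWodd : ∀ x i, Wx (-x) i = -Wx x i := fun x i =>
    congrFun (congrFun (bf.W_neg (Matrix.of fun i j => x j i)) i) j
  let f : Ω → ι → ℂ := fun ω i => g * bf.W (Hhat ω) i j + n * v i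
  let b : Ω → ℂ := fun ω => ∑ i, star (Hhat ω i k) * v i
  let A : Ω → ℂ := fun ω => ∑ i, star (Hhat ω i k) * bf.W (Hhat ω) i j
  let a : Ω → ℂ := fun ω => g * A ω + n * b ω
  obtain ⟨hb, hb2⟩ := h.moments_inner_const k v
  have hA' : MemLp (fun ω => g * A ω) 2 μ := hA.const_mul g
  have hb' : MemLp (fun ω => n * b ω) 2 μ := hb.const_mul n
  have hf : ∀ i, MemLp (fun ω => f ω i) 2 μ := fun i => ((hW i).const_mul g).add (memLp_const _)
  have hgain : ∀ ω, gain H F k j ω =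
      a ω + ∑ i, star (H ω i k - Hhat ω i k) * f ω i := by
    intro ω
    have hFj : ∀ i, F ω i j = f ω i := fun i => by
      simp only [hF, Precoder.F, Matrix.add_apply, Matrix.mul_diagonal, Matrix.vecMulVec_apply, f,
        g, n]
      ring
    have ha : a ω = ∑ i, star (Hhat ω i k) * f ω i := by
      simp only [a, A, b, f, Finset.mul_sum, ← Finset.sum_add_distrib]
      exact Finset.sum_congr rfl fun i _ => by ring
    rw [ha, ← Finset.sum_add_distrib, gain, Matrix.mul_apply]
    refine Finset.sum_congr rfl fun i _ => ?_
    rw [hFj, star_sub, Matrix.conjTranspose_apply]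
    ring
  have hind : IndepFun (fun ω i => H ω i k - Hhat ω i k) (fun ω => (f ω, a ω)) μ := by
    have hm : Measurable fun M : ι → Fin K → ℂ =>
        ((fun i => g * Wx (fun j i => M i j) i + n * v i,
          g * ∑ i, star (M i k) * Wx (fun j i => M i j) i + n * ∑ i, star (M i k) * v i) :
          (ι → ℂ) × ℂ) := by
      have ht : Measurable fun (M : ι → Fin K → ℂ) (j : Fin K) (i : ι) => M i j := by fun_prop
      have hWt : ∀ i, Measurable fun M : ι → Fin K → ℂ => Wx (fun j i => M i j) i :=
        fun i => (hWm i).comp ht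
      have hst : ∀ i, Measurable fun M : ι → Fin K → ℂ => star (M i k) :=
        fun i => Continuous.measurable (by fun_prop)
      fun_prop
    exact (h.indep_error k).comp measurable_id hm
  obtain ⟨m1, m2, m3⟩ := moments_add_inner_gaussian (S.ε_nonneg k) (h.law_error k) hind hf
    (hA'.add hb')
  simp_rw [funext hgain]
  refine ⟨m1, m2.trans ?_, m3.trans ?_⟩
  · have hb0 : ∫ ω, b ω ∂μ = 0 := by
      refine h.integral_odd (φ := fun x => ∑ i, star (x k i) * v i)
        (Continuous.measurable (by fun_prop)) fun x => ?_
      simp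
    rw [integral_add (hA'.integrable (by norm_num)) (hb'.integrable (by norm_num)),
      integral_const_mul, integral_const_mul, hb0, mul_zero, add_zero]
  -- `A` is even in the estimates and `b` is odd.
  · have hab : ∫ ω, (g * A ω) * star (n * b ω) ∂μ = 0 := by
      refine h.integral_odd (φ := fun x => (g * ∑ i, star (x k i) * Wx x i) *
        star (n * ∑ i, star (x k i) * v i)) ?_ fun x => ?_
      · have h1 : Measurable fun x : Fin K → ι → ℂ => star (n * ∑ i, star (x k i) * v i) :=
          Continuous.measurable (by fun_prop)
        have hst : ∀ i, Measurable fun x : Fin K → ι → ℂ => star (x k i) :=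
          fun i => Continuous.measurable (by fun_prop)
        fun_prop
      · simp [hWodd]
    have hWv : ∀ i, ∫ ω, (g * bf.W (Hhat ω) i j) * star (n * v i) ∂μ = 0 := by
      intro i
      refine h.integral_odd (φ := fun x => (g * Wx x i) * star (n * v i)) (by fun_prop)
        fun x => ?_
      simp [hWodd]
    have hf2 : ∀ i, ∫ ω, ‖f ω i‖ ^ 2 ∂μ =
        γ j * ∫ ω, ‖bf.W (Hhat ω) i j‖ ^ 2 ∂μ + η j * ‖v i‖ ^ 2 := by
      intro i
      rw [integral_norm_sq_add_of_orthogonal ((hW i).const_mul g) (memLp_const _) (hWv i)]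
      simp_rw [norm_mul, mul_pow, hg, hn, integral_const_mul]
      simp
    rw [integral_norm_sq_add_of_orthogonal hA' hb' hab]
    simp_rw [hf2, norm_mul, mul_pow, hg, hn, integral_const_mul, Finset.sum_add_distrib,
      ← Finset.mul_sum, hv]
    -- The beam enters with `ξ_k` through the estimate and with `ε_k` through the error, in total
    -- `β_k`.
    rw [hb2, hv, System.ε]
    simp only [A]
    ring

end EstimateStatistics

/-- Moments of the precoder, for maximum ratio transmission and zero forcing. -/
theorem Precoder.moments_W [IsProbabilityMeasure μ] (bf : Precoder)
    (hbf : bf = Precoder.ZF → K < Fintype.card ι) (h : EstimateStatistics S μ H Hhat)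
    (k j : Fin K) :
    (∀ i, MemLp (fun ω => bf.W (Hhat ω) i j) 2 μ) ∧
    MemLp (fun ω => ∑ i, star (Hhat ω i k) * bf.W (Hhat ω) i j) 2 μ ∧
    ‖∫ ω, ∑ i, star (Hhat ω i k) * bf.W (Hhat ω) i k ∂μ‖ ^ 2 = bf.lam S (Fintype.card ι) k ∧
    ∫ ω, ‖∑ i, star (Hhat ω i k) * bf.W (Hhat ω) i j‖ ^ 2 ∂μ +
        S.ε k * ∑ i, ∫ ω, ‖bf.W (Hhat ω) i j‖ ^ 2 ∂μ =
      Fintype.card ι * bf.ζ S (Fintype.card ι) k j +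
        if j = k then bf.lam S (Fintype.card ι) k else 0 := by
  cases bf with
  | MRT =>
    simp only [Precoder.W, Precoder.lam, Precoder.ζ]
    obtain ⟨s1, s2, s3⟩ := h.moments_inner_self k
    simp_rw [integral_norm_sq_eval_complexGaussianVec (S.ξ_pos j).le (h.law_estimate j)]
    refine ⟨fun i => h.memLp_estimate i j (by simp), ?_, ?_, ?_⟩
    · by_cases hjk : k = j
      · exact hjk ▸ s1
      · exact (h.moments_inner_estimate hjk).1
    · rw [s2, Complex.norm_real, Real.norm_eq_abs, sq_abs]
      ring
    -- By `ξ_k + ε_k = β_k` both cases give `N_t β_k ξ_j`; for `j = k` the squared mean `N_t² ξ_k²`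
    -- is added.
    · by_cases hjk : k = j
      · subst hjk
        rw [s3, if_pos rfl, System.ε]
        simp
        ring
      · rw [(h.moments_inner_estimate hjk).2, if_neg (Ne.symm hjk), System.ε]
        simp
        ring
  | ZF =>
    have hcard := hbf rfl
    have hcard' : Fintype.card (Fin K) < Fintype.card ι := by simpa using hcard
    simp only [Precoder.W, Precoder.lam, Precoder.ζ]
    have hLI := ae_linearIndependent S.ξ_pos h.law_estimate h.indep_estimate hcard'
    have hinv := lintegral_inv_sq_spanDist_removeIndex S.ξ_pos h.law_estimate h.indep_estimate
      hcard'
    have hm : ∀ i j, AEMeasurable (fun ω => (Hhat ω * ((Hhat ω)ᴴ * Hhat ω)⁻¹) i j) μ :=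
      fun i j => (Precoder.ZF.measurable_W i j).comp_aemeasurable h.aemeasurable_estimate
    have hδ : ∀ l, (fun ω => ∑ i, star (Hhat ω i k) * (Hhat ω * ((Hhat ω)ᴴ * Hhat ω)⁻¹) i l)
        =ᵐ[μ] fun _ => if k = l then 1 else 0 := by
      intro l
      filter_upwards [hLI] with ω hω
      have := congrFun (congrFun (conjTranspose_mul_zeroForcing hω) k) l
      rw [Matrix.one_apply] at this
      exact this
    -- Working in `ENNReal` yields integrability of `‖w_j‖²` together with its mean.
    have hsum : ∫⁻ ω, ENNReal.ofReal (∑ i, ‖(Hhat ω * ((Hhat ω)ᴴ * Hhat ω)⁻¹) i j‖ ^ 2) ∂μ =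
        ENNReal.ofReal (1 / (S.ξ j * ((Fintype.card ι : ℝ) - K))) := by
      have hj := hinv j
      rw [Fintype.card_fin] at hj
      rw [← hj]
      refine lintegral_congr_ae ?_
      filter_upwards [hLI] with ω hω
      have hsd := sum_norm_sq_zeroForcing hω j
      rw [hsd, ENNReal.ofReal_inv_of_pos]
      -- Were the distance zero, its real inverse would be `0` and the column `w_j` would vanish,
      -- against `ĥ_jᴴ w_j = 1`.
      refine (sq_nonneg _).lt_of_ne fun h0 => ?_
      rw [← h0, inv_zero, Finset.sum_eq_zero_iff_of_nonneg fun i _ => sq_nonneg _] at hsd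
      have h1 := congrFun (congrFun (conjTranspose_mul_zeroForcing hω) j) j
      rw [Matrix.mul_apply, Matrix.one_apply_eq, Finset.sum_eq_zero fun i hi => ?_] at h1
      · exact zero_ne_one h1
      · rw [norm_eq_zero.1 (pow_eq_zero_iff two_ne_zero |>.1 (hsd i hi)), mul_zero]
    set W := fun ω => Hhat ω * ((Hhat ω)ᴴ * Hhat ω)⁻¹ with hW
    have hTnn : ∀ ω, 0 ≤ ∑ i, ‖W ω i j‖ ^ 2 := fun ω => Finset.sum_nonneg fun i _ => sq_nonneg _
    have hTm : AEStronglyMeasurable (fun ω => ∑ i, ‖W ω i j‖ ^ 2) μ :=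
      (Finset.aemeasurable_fun_sum _ fun i _ => ((hm i j).norm.pow_const 2)).aestronglyMeasurable
    have hT : Integrable (fun ω => ∑ i, ‖W ω i j‖ ^ 2) μ := by
      refine ⟨hTm, ?_⟩
      rw [hasFiniteIntegral_iff_ofReal (Filter.Eventually.of_forall hTnn)]
      exact hsum ▸ ENNReal.ofReal_lt_top
    have hξj := S.ξ_pos j
    have hK : (0 : ℝ) < (Fintype.card ι : ℝ) - K := sub_pos.2 (by exact_mod_cast hcard)
    have hN : (0 : ℝ) < Fintype.card ι := by exact_mod_cast (Nat.zero_le K).trans_lt hcard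
    have hTint : ∫ ω, ∑ i, ‖W ω i j‖ ^ 2 ∂μ = 1 / (S.ξ j * ((Fintype.card ι : ℝ) - K)) := by
      rw [integral_eq_lintegral_of_nonneg_ae (Filter.Eventually.of_forall hTnn) hTm]
      exact (congrArg ENNReal.toReal hsum).trans (ENNReal.toReal_ofReal (by positivity))
    have hWi : ∀ i, Integrable (fun ω => ‖W ω i j‖ ^ 2) μ := fun i =>
      hT.mono' ((hm i j).norm.pow_const 2).aestronglyMeasurable
        (Filter.Eventually.of_forall fun ω => by
          rw [Real.norm_of_nonneg (sq_nonneg _)]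
          exact Finset.single_le_sum (f := fun i => ‖W ω i j‖ ^ 2) (fun i _ => sq_nonneg _)
            (Finset.mem_univ i))
    refine ⟨fun i => (memLp_two_iff_integrable_sq_norm (hm i j).aestronglyMeasurable).2 (hWi i),
      (memLp_const _).ae_eq (hδ j).symm, ?_, ?_⟩
    · rw [integral_congr_ae (hδ k)]
      simp
    · rw [← integral_finsetSum _ fun i _ => hWi i, hTint,
        integral_congr_ae ((hδ j).mono fun ω hω => by
          simpa only using congrArg (fun z : ℂ => ‖z‖ ^ 2) hω)]
      have e : S.ε k * (1 / (S.ξ j * ((Fintype.card ι : ℝ) - K))) =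
          Fintype.card ι * (S.ε k / (Fintype.card ι * ((Fintype.card ι : ℝ) - K)) *
            (1 / S.ξ j)) := by
        field_simp
      rw [e, add_comm]
      by_cases hjk : k = j
      · simp [hjk]
      · simp [hjk, Ne.symm hjk]

end Gain

/-! ### From the moments to the achievable rate -/

theorem integral_norm_sub_integral_sq {Ω : Type*} [MeasurableSpace Ω] {μ : Measure Ω}
    [IsProbabilityMeasure μ] {X : Ω → ℂ} (hX : MemLp X 2 μ) :
    ∫ ω, ‖X ω - ∫ ω', X ω' ∂μ‖ ^ 2 ∂μ = ∫ ω, ‖X ω‖ ^ 2 ∂μ - ‖∫ ω, X ω ∂μ‖ ^ 2 := by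
  set m := ∫ ω, X ω ∂μ with hm
  have hi : Integrable X μ := hX.integrable (by norm_num)
  have h := integral_norm_sq_add_of_orthogonal (hX.sub (memLp_const m)) (memLp_const m) (by
    simp only [Pi.sub_apply]
    rw [integral_mul_const, integral_sub hi (integrable_const m), ← hm]
    simp)
  simp only [Pi.sub_apply, sub_add_cancel, integral_const, probReal_univ, one_smul] at h
  rw [h, add_sub_cancel_right]

/-- Variance plus interference is the total second moment over all streams minus the squared mean
`λ_k γ_k`, which cancels the extra term of the stream `j = k`. -/
theorem EstimateStatistics.achievableRate_eq {Ω ι : Type*} [MeasurableSpace Ω] {μ : Measure Ω}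
    [IsProbabilityMeasure μ] [Fintype ι] {K : ℕ} {S : System K} {H Hhat F : Ω → Matrix ι (Fin K) ℂ}
    (h : EstimateStatistics S μ H Hhat) (bf : Precoder)
    (hbf : bf = Precoder.ZF → K < Fintype.card ι)
    (v : ι → ℂ) (hv : ∑ i, ‖v i‖ ^ 2 = Fintype.card ι) {γ η : Fin K → ℝ} (hγ : ∀ k, 0 ≤ γ k)
    (hη : ∀ k, 0 ≤ η k) (hF : ∀ ω, F ω = bf.F (Hhat ω) v γ η) (k : Fin K) :
    (∀ j, MemLp (gain H F k j) 2 μ) ∧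
    achievableRate S μ H F k =
      S.τbar * Real.logb 2 (1 + bf.lam S (Fintype.card ι) k * γ k /
        (Fintype.card ι * S.β k * ∑ j, η j +
          Fintype.card ι * (bf.ζ S (Fintype.card ι) k ⬝ᵥ γ) + S.σsq)) := by
  have hW := bf.moments_W hbf h k
  have hg := fun j => h.moments_gain bf v hv hγ hη hF k j (hW j).1 (hW j).2.1
  refine ⟨fun j => (hg j).1, ?_⟩
  have hmean : ‖∫ ω, gain H F k k ω ∂μ‖ ^ 2 = bf.lam S (Fintype.card ι) k * γ k := by
    rw [(hg k).2.1, norm_mul, mul_pow, (hW k).2.2.1, Complex.norm_real, Real.norm_eq_abs, sq_abs,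
      Real.sq_sqrt (hγ k), mul_comm]
  have hsum : ∑ j, ∫ ω, ‖gain H F k j ω‖ ^ 2 ∂μ =
      Fintype.card ι * S.β k * ∑ j, η j + Fintype.card ι * (bf.ζ S (Fintype.card ι) k ⬝ᵥ γ) +
        bf.lam S (Fintype.card ι) k * γ k := by
    have e : ∀ j, ∫ ω, ‖gain H F k j ω‖ ^ 2 ∂μ = Fintype.card ι * S.β k * η j +
        Fintype.card ι * (bf.ζ S (Fintype.card ι) k j * γ j) +
          if j = k then bf.lam S (Fintype.card ι) k * γ k else 0 := fun j => by
      rw [(hg j).2.2, (hW j).2.2.2]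
      split_ifs with hj
      · subst hj
        ring
      · ring
    simp_rw [e, Finset.sum_add_distrib, ← Finset.mul_sum]
    simp [dotProduct]
  rw [achievableRate, integral_norm_sub_integral_sq (hg k).1, hmean, sub_add_eq_add_sub,
    Finset.add_sum_erase Finset.univ (fun j => ∫ ω, ‖gain H F k j ω‖ ^ 2 ∂μ) (Finset.mem_univ k),
    hsum, add_sub_cancel_right]

end ISAC

theorem theorem1 {Ω : Type*} [MeasurableSpace Ω] (μ : Measure Ω) [IsProbabilityMeasure μ]
    {K Nth Ntv : ℕ} (S : ISAC.System K) (bf : ISAC.Precoder)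
    (hbf : bf = ISAC.Precoder.ZF → K < Nth * Ntv)
    (v : Fin Nth × Fin Ntv → ℂ) (hv : ∑ i, ‖v i‖ ^ 2 = ((Nth * Ntv : ℕ) : ℝ))
    (γ η : Fin K → ℝ) (hγ : ∀ k, 0 ≤ γ k) (hη : ∀ k, 0 ≤ η k)
    (ρ : ℝ) (hρ : ρ = ∑ k, η k)
    (H Hhat F : Ω → Matrix (Fin Nth × Fin Ntv) (Fin K) ℂ)
    (hH : ISAC.EstimateStatistics S μ H Hhat ∨
      (S.OrthogonalPilots ∧ ISAC.IsTrainingMMSE S μ H Hhat))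
    (hF : ∀ ω, F ω = bf.F (Hhat ω) v γ η) (k : Fin K) :
    (∀ j, MemLp (ISAC.gain H F k j) 2 μ) ∧
    ISAC.achievableRate S μ H F k =
      S.τbar * Real.logb 2 (1 + bf.lam S (Nth * Ntv) k * γ k /
        (((Nth * Ntv : ℕ) : ℝ) * S.β k * ρ +
          ((Nth * Ntv : ℕ) : ℝ) * (bf.ζ S (Nth * Ntv) k ⬝ᵥ γ) + S.σsq)) := by
  have h : ISAC.EstimateStatistics S μ H Hhat := hH.elim id fun h => h.2.estimateStatistics h.1
  have hc : Nth * Ntv = Fintype.card (Fin Nth × Fin Ntv) := by simp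
  rw [hc] at hbf hv ⊢
  rw [hρ]
  exact h.achievableRate_eq bf hbf v hv hγ hη hF k
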